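/- **Theorem 3.1.** Let $w\in C_0^\infty(\mathbb R)'$ be a distribution, regarded as a continuous antilinear functional $\theta\mapsto\langle w,\theta\rangle$ on $C_0^\infty(\mathbb R)$ (complex valued; $\langle w,\theta\rangle=\int w\,\overline{\theta}\,dx$ for locally integrable $w$), and suppose that $w(x)=\overline{w(-x)}$. Let $$\mathbf w[f,f]=\langle w, f\circ\bar f\rangle,\qquad (f\circ g)(x)=\int_{\mathbb R} f(x+y)\,g(y)\,dy,\qquad f\in C_0^\infty(\mathbb R),$$ so that $\mathbf w[f,f]=\iint w(x-y)f(y)\overline{f(x)}\,dx\,dy$ for locally integrable $w$; this form is real. Assume that, for some $\gamma\in\mathbb R$, $$\mathbf w[f,f]\ge\gamma\|f\|^2_{L^2(\mathbb R)}\qquad\text{for all } f\in C_0^\infty(\mathbb R).$$ Then there is a unique real (signed, locally finite) Borel measure $\mathsf M$ on $\mathbb R$ with $\int(1+\lambda^2)^{-p}\,d|\mathsf M|(\lambda)<\infty$ for some $p$ such that $$w(x)=\frac1{2\pi}\int_{\mathbb R}e^{-ix\lambda}\,d\mathsf M(\lambda)$$ in the sense of distributions, and $\mathsf M(X)\ge\gamma|X|$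 for all bounded Borel sets $X$, where $|X|$ is the Lebesgue measure of $X$. The form $\mathbf w$ is closable in $L^2(\mathbb R)$ (that is, $f_n\in C_0^\infty(\mathbb R)$, $\|f_n\|\to0$ and $\mathbf w[f_n-f_m,f_n-f_m]\to0$ as $n,m\to\infty$ imply $\mathbf w[f_n,f_n]\to0$) if and only if $\mathsf M$ is absolutely continuous with respect to Lebesgue measure. In that case $\mathbf w$ is closed on the set $$\Big\{f\in L^2(\mathbb R):\ \int_{\mathbb R}|\widehat f(\lambda)|^2\,d\mathsf M(\lambda)<\infty\Big\},\qquad \widehat f(\lambda)=\frac1{\sqrt{2\pi}}\int_{\mathbb R}e^{ix\lambda}f(x)\,dx,$$ where convergence of the integral means convergence with respect to $|\mathsf M|$. That is, this set consists exactly of all limits $f$ in $L^2(\mathbb R)$ of sequences $f_n\in C_0^\infty(\mathbb R)$ with $\mathbf w[f_n-f_m,f_n-f_m]\to0$ as $n,m\to\infty$, and $\mathbf w[f_n,f_n]\to\int|\widehat f|^2\,d\mathsf M$ for every such sequence. -/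

import Mathlib

open MeasureTheory Filter Topology Set
open scoped Distributions ENNReal FourierTransform

noncomputable section

/-! ### Closable forms -/

namespace QuadForm

variable {D H : Type*} [AddCommGroup D] [NormedAddCommGroup H]

/-- For a semibounded quadratic form `q` on `D`, where `j : D → H` is the inclusion of `D` into the
Hilbert space `H`: the sequence `u` in `D` converges to `f` in `H` and is Cauchy in the form norm.
The form norm is `√(q[u] + β‖u‖²)` with `β` so large that `q + β‖·‖² ≥ ‖·‖²`. Since `u`
converges in `H`, the differences `u n - u m` tend to `0` in `H`, so that for every `β`
the Cauchy condition amounts to `q[u n - u m] → 0`. -/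
def Approximates (j : D → H) (q : D → ℝ) (u : ℕ → D) (f : H) : Prop :=
  Tendsto (fun n => j (u n)) atTop (𝓝 f) ∧
    Tendsto (fun p : ℕ × ℕ => q (u p.1 - u p.2)) atTop (𝓝 0)

/-- A semibounded form `q` is closable in `H` if `‖u n‖ → 0` and `q[u n - u m] → 0` imply
`q[u n] → 0`. -/
def Closable (j : D → H) (q : D → ℝ) : Prop :=
  ∀ u : ℕ → D, Approximates j q u 0 → Tendsto (fun n => q (u n)) atTop (𝓝 0)

/-- The closure of `D` in the form norm, realized as a subset of `H` (for a closable form). -/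
def closureDomain (j : D → H) (q : D → ℝ) : Set H :=
  {f | ∃ u : ℕ → D, Approximates j q u f}

/-- The form `q` is closable, the closure of its domain in the form norm is `E`, and its extension
by continuity to `E` is `t`; that is, `q`, extended by `t`, is closed on `E`. -/
structure ClosedOn (j : D → H) (q : D → ℝ) (E : Set H) (t : H → ℝ) : Prop where
  closable : Closable j q
  domain_eq : closureDomain j q = E
  extension : ∀ f ∈ E, ∀ u : ℕ → D, Approximates j q u f →
    Tendsto (fun n => q (u n)) atTop (𝓝 (t f))

end QuadForm

/-! ### Test functions and distributions on the line -/

/-- `C₀^∞(ℝ)`, complex valued, with its usual topology. -/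
abbrev TestFn : Type := 𝓓((⊤ : TopologicalSpace.Opens ℝ), ℂ)

/-- `C₀^∞(ℝ)'`: distributions, as continuous antilinear functionals
(`⟨w, θ⟩ = ∫ w(x) conj (θ(x)) dx` for a locally integrable function `w`). -/
abbrev AntiDistribution : Type := TestFn →L⋆[ℂ] ℂ

namespace TestFn

/-- `x ↦ conj (f x)`. -/
def conjugate (f : TestFn) : TestFn where
  toFun x := starRingEnd ℂ (f x)
  contDiff' := Complex.conjCLE.contDiff.comp f.contDiff
  hasCompactSupport' := f.hasCompactSupport.comp_left (map_zero _)
  tsupport_subset' := subset_univ _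

/-- `x ↦ f (-x)`. -/
def reflect (f : TestFn) : TestFn where
  toFun x := f (-x)
  contDiff' := f.contDiff.comp contDiff_neg
  hasCompactSupport' := f.hasCompactSupport.comp_homeomorph (Homeomorph.neg ℝ)
  tsupport_subset' := subset_univ _

theorem integral_eq_convolution (f g : TestFn) (x : ℝ) :
    ∫ y : ℝ, f (x + y) * g y =
      convolution (f : ℝ → ℂ) (reflect g : ℝ → ℂ) (ContinuousLinearMap.mul ℝ ℂ) volume x := by
  rw [convolution_def, ← integral_add_left_eq_self
    (fun t => ContinuousLinearMap.mul ℝ ℂ (f t) (reflect g (x - t))) x]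
  refine integral_congr_ae (Eventually.of_forall fun y => ?_)
  change f (x + y) * g y = f (x + y) * g (-(x - (x + y)))
  congr 2
  ring

/-- `(f ∘ g)(x) = ∫ f(x + y) g(y) dy`, the convolution of `f` with the reflection of `g`. -/
def corr (f g : TestFn) : TestFn where
  toFun x := ∫ y : ℝ, f (x + y) * g y
  contDiff' := by
    rw [funext (integral_eq_convolution f g)]
    exact f.hasCompactSupport.contDiff_convolution_left _ f.contDiff
      (reflect g).contDiff.continuous.locallyIntegrable
  hasCompactSupport' := by
    rw [funext (integral_eq_convolution f g)]
    exact f.hasCompactSupport.convolution _ (reflect g).hasCompactSupport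
  tsupport_subset' := subset_univ _

/-- The class of a test function in `L²(ℝ)`. -/
def toL2 (f : TestFn) : Lp ℂ 2 (volume : Measure ℝ) :=
  (f.contDiff.continuous.memLp_of_hasCompactSupport f.hasCompactSupport :
    MemLp (f : ℝ → ℂ) 2 volume).toLp f

end TestFn

namespace AntiDistribution

/-- `w(x) = conj (w(-x))` in the sense of distributions. -/
def IsHermitian (w : AntiDistribution) : Prop :=
  ∀ θ : TestFn, w θ = starRingEnd ℂ (w θ.conjugate.reflect)

/-- The convolution quadratic form `𝐰[f,f] = ⟨w, f ∘ conj f⟩`, which is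
`∬ w(x - y) f(y) conj (f(x)) dx dy` for a locally integrable function `w`. For Hermitian `w` the
value `⟨w, f ∘ conj f⟩` is real (see `im_eq_zero`), so that taking the real part only changes the
type. -/
def form (w : AntiDistribution) (f : TestFn) : ℝ := (w (f.corr f.conjugate)).re

theorem im_eq_zero {w : AntiDistribution} (hw : w.IsHermitian) (f : TestFn) :
    (w (f.corr f.conjugate)).im = 0 := by
  have h : (f.corr f.conjugate).conjugate.reflect = f.corr f.conjugate := by
    refine TestFunction.ext fun x => ?_
    change starRingEnd ℂ (∫ y : ℝ, f (-x + y) * starRingEnd ℂ (f y)) =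
      ∫ y : ℝ, f (x + y) * starRingEnd ℂ (f y)
    rw [← integral_conj, ← integral_add_left_eq_self
      (fun y => starRingEnd ℂ (f (-x + y) * starRingEnd ℂ (f y))) x]
    refine integral_congr_ae (Eventually.of_forall fun y => ?_)
    simp [mul_comm]
  have h2 := hw (f.corr f.conjugate)
  rw [h] at h2
  exact Complex.conj_eq_iff_im.mp h2.symm

end AntiDistribution

/-! ### Real measures of polynomial growth -/

/-- A real (signed, locally finite) Borel measure `M = M₊ - M₋` on the line with at most polynomial
growth, given by its Jordan decomposition: `∫ (1 + s²)^(-p) d|M|(s) < ∞` for some `p`. -/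
@[ext]
structure PolyMeasure where
  /-- the positive part -/
  pos : Measure ℝ
  /-- the negative part -/
  neg : Measure ℝ
  mutuallySingular : pos ⟂ₘ neg
  growth : ∃ p : ℝ, ∫⁻ s, ENNReal.ofReal ((1 + s ^ 2) ^ (-p)) ∂(pos + neg) < ∞

namespace PolyMeasure

/-- The variation `|M|`. -/
def variation (M : PolyMeasure) : Measure ℝ := M.pos + M.neg

/-- The value `M(X)` (for bounded Borel sets `X`, where both parts are finite). -/
def val (M : PolyMeasure) (X : Set ℝ) : ℝ := M.pos.real X - M.neg.real X

/-- The integral of a function with respect to `M` (for `|M|`-integrable functions). -/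
def integral {E : Type*} [NormedAddCommGroup E] [NormedSpace ℝ E] (M : PolyMeasure) (g : ℝ → E) :
    E :=
  (∫ s, g s ∂M.pos) - ∫ s, g s ∂M.neg

/-- Absolute continuity with respect to Lebesgue measure. -/
def IsAbsolutelyContinuous (M : PolyMeasure) : Prop :=
  M.variation ≪ (volume : Measure ℝ)

/-- `w(x) = (2π)⁻¹ ∫ exp(-i x s) dM(s)`, the Fourier transform being understood in the sense of
distributions: `⟨w, θ⟩ = (2π)⁻¹ ∫ (∫ exp(-i x s) conj (θ(x)) dx) dM(s)`. The inner integral is a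
Schwartz function of `s`, so that the outer one converges absolutely. -/
def Represents (M : PolyMeasure) (w : AntiDistribution) : Prop :=
  ∀ θ : TestFn, w θ = (2 * Real.pi : ℂ)⁻¹ *
    M.integral fun s : ℝ => ∫ x : ℝ, Complex.exp (-(Complex.I * x * s)) * starRingEnd ℂ (θ x)

end PolyMeasure

/-- The unitary Fourier transform `f̂(s) = (2π)^(-1/2) ∫ exp(i x s) f(x) dx` on `L²(ℝ)`, expressed
through Mathlib's `𝓕⁻ f (t) = ∫ exp(2 π i x t) f(x) dx`. -/
def hatL2 (f : Lp ℂ 2 (volume : Measure ℝ)) (s : ℝ) : ℂ :=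
  ((Real.sqrt (2 * Real.pi) : ℝ) : ℂ)⁻¹ *
    (𝓕⁻ f : Lp ℂ 2 (volume : Measure ℝ)) (s / (2 * Real.pi))

/-- The functions `f ∈ L²(ℝ)` such that `∫ |f̂|² dM` converges. -/
def energySpace (M : PolyMeasure) : Set (Lp ℂ 2 (volume : Measure ℝ)) :=
  {f | ∫⁻ s, ‖hatL2 f s‖ₑ ^ 2 ∂M.variation < ∞}

end

open scoped ComplexConjugate SchwartzMap BoundedContinuousFunction

noncomputable section

/-! Existence is the Bochner-Schwartz theorem. Fix a test function `k` of norm one and let `κ` be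
its autocorrelation, so that `κ 0 = 1`. A dilate `κ (c x)` times `exp(-i x s)` is again the
autocorrelation of a test function of norm one (`exists_corr_eq`), so `w` takes a real value at
least `γ` on it. Minus `γ`, these values are nonnegative densities in `s`. Up to the factor `2π`,
integrating the conjugate transform of `η` against them gives the value of `w` on `η` times the
cutoff, minus `γ` times the conjugate of `η 0` (`apply_mul_eq_integral`); this rests on the fact
that `w` is locally a derivative of an integrable function (`exists_eq_integral_iteratedDeriv`).
Testing with modulated autocorrelations bounds the mass on short intervals polynomially, uniformly
in the dilation (`exists_approxDensity_growth`), so weighted Prokhorov compactness gives a limit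
measure `ν` as `c → 0` (`exists_limit_of_lintegral_japWeight_le`). Then `M = ν + γ dx`, and its
negative part is at most `max (-γ) 0` times Lebesgue measure.

Uniqueness holds because transforms of test functions separate measures of polynomial growth: they
are stable under multiplication by characters and have no common zero
(`ae_eq_zero_of_integral_ft_mul`). The same fact makes them dense in `L²` of any such measure
(`exists_hat_near`).

For closability, the form equals `∫ |f̂|² dM`, and the bound on the negative part makes the form
norm equivalent to the norm of `f̂` in `L²(|M| + dx)`. By density, the abstract completion is this
whole space, and the limit in `L²(ℝ)` only remembers a class modulo Lebesgue-null sets. If `M` is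
absolutely continuous, nothing is lost: closability and the description of the domain follow. If
not, the indicator of a bounded Lebesgue-null set charged by `M` is the limit of a form-Cauchy
sequence that tends to zero in `L²(ℝ)` while its form values tend to the nonzero mass of the set. -/

theorem norm_toLp_two_sq {α : Type*} [MeasurableSpace α] {μ : Measure α} {f : α → ℂ}
    (hf : MemLp f 2 μ) : ‖hf.toLp f‖ ^ 2 = ∫ x, ‖f x‖ ^ 2 ∂μ := by
  rw [norm_sq_eq_re_inner (𝕜 := ℂ), L2.inner_def, ← integral_re (L2.integrable_inner _ _)]
  refine integral_congr_ae ?_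
  filter_upwards [hf.coeFn_toLp] with x hx
  rw [hx, ← norm_sq_eq_re_inner (𝕜 := ℂ)]

/-! ### Fourier transforms of test functions -/

namespace TestFn

/-- A test function as a Schwartz function. -/
def toSchwartz (θ : TestFn) : 𝓢(ℝ, ℂ) := θ.hasCompactSupport.toSchwartzMap θ.contDiff

@[simp] theorem toSchwartz_apply (θ : TestFn) (x : ℝ) : θ.toSchwartz x = θ x := rfl

theorem integrable (θ : TestFn) : Integrable (θ : ℝ → ℂ) :=
  θ.toSchwartz.integrable

/-- The function `s ↦ ∫ exp(i x s) θ(x) dx`. -/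
def ft (θ : TestFn) (s : ℝ) : ℂ := ∫ x : ℝ, Complex.exp (Complex.I * x * s) * θ x

theorem ft_eq_fourierInv (θ : TestFn) (s : ℝ) :
    θ.ft s = (𝓕⁻ θ.toSchwartz : 𝓢(ℝ, ℂ)) (s / (2 * Real.pi)) := by
  rw [SchwartzMap.fourierInv_coe, Real.fourierInv_eq', ft]
  refine integral_congr_ae (Eventually.of_forall fun x => ?_)
  simp only [smul_eq_mul, toSchwartz_apply]
  congr 2
  have : (Real.pi : ℂ) ≠ 0 := by exact_mod_cast Real.pi_ne_zero
  simp
  field_simp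

/-- Multiplication by `(2π)⁻¹`. -/
def scaleEquiv : ℝ ≃L[ℝ] ℝ :=
  ContinuousLinearEquiv.smulLeft (Units.mk0 ((2 * Real.pi)⁻¹ : ℝ) (by positivity))

/-- The Fourier transform of a test function as a Schwartz function. -/
def ftS (θ : TestFn) : 𝓢(ℝ, ℂ) :=
  SchwartzMap.compCLMOfContinuousLinearEquiv ℂ scaleEquiv (𝓕⁻ θ.toSchwartz)

@[simp] theorem ftS_apply (θ : TestFn) (s : ℝ) : θ.ftS s = θ.ft s := by
  rw [ft_eq_fourierInv, div_eq_inv_mul]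
  rfl

theorem coe_ftS (θ : TestFn) : (θ.ftS : ℝ → ℂ) = θ.ft := funext θ.ftS_apply

theorem continuous_ft (θ : TestFn) : Continuous θ.ft := by
  rw [← coe_ftS]; exact θ.ftS.continuous

theorem integrable_ft (θ : TestFn) : Integrable θ.ft := by
  rw [← coe_ftS]; exact θ.ftS.integrable

theorem integrable_pow_mul_ft (θ : TestFn) (j : ℕ) :
    Integrable fun s : ℝ => ((s : ℂ) ^ j * θ.ft s) := by
  have h := θ.ftS.integrable_pow_mul volume j
  refine h.mono' (by have := θ.continuous_ft; fun_prop) (Eventually.of_forall fun s => ?_)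
  simp

theorem exists_ft_decay (θ : TestFn) (k : ℕ) :
    ∃ C : ℝ, 0 < C ∧ ∀ s : ℝ, (1 + s ^ 2) ^ k * ‖θ.ft s‖ ≤ C := by
  -- The order is `2 * k` because `(1 + s²)^k ≤ (1 + |s|)^(2k)`; the final `+ 1` makes the constant
  -- positive.
  refine ⟨2 ^ (2 * k) * (Finset.Iic (2 * k, 0)).sup
    (fun m => SchwartzMap.seminorm ℂ m.1 m.2) θ.ftS + 1, by positivity, fun s => ?_⟩
  have h := SchwartzMap.one_add_le_sup_seminorm_apply (𝕜 := ℂ) (m := (2 * k, 0)) (k := 2 * k)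
    (n := 0) le_rfl le_rfl θ.ftS s
  rw [norm_iteratedFDeriv_zero, ftS_apply] at h
  refine le_trans ?_ (h.trans (by linarith))
  gcongr
  rw [pow_mul]
  gcongr
  have := abs_nonneg s
  have h2 := sq_abs s
  rw [Real.norm_eq_abs]
  nlinarith

theorem fourier_fourierInv_apply (θ : TestFn) :
    (θ : ℝ → ℂ) = 𝓕 ((𝓕⁻ θ.toSchwartz : 𝓢(ℝ, ℂ)) : ℝ → ℂ) := by
  rw [← SchwartzMap.fourier_coe, FourierTransform.fourier_fourierInv_eq]
  rfl

theorem integral_comp_two_pi (g : ℝ → ℂ) :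
    ∫ s : ℝ, g (s / (2 * Real.pi)) = (2 * Real.pi : ℂ) * ∫ t : ℝ, g t := by
  rw [Measure.integral_comp_div, abs_of_pos Real.two_pi_pos, Complex.real_smul]
  push_cast
  rfl

/-- Fourier inversion differentiated `j` times; the substitution `s = 2πt` passes to the
normalization without `2π` in the exponent. -/
theorem iteratedDeriv_eq_integral (θ : TestFn) (j : ℕ) (x : ℝ) :
    iteratedDeriv j θ x = (2 * Real.pi : ℂ)⁻¹ *
      ∫ s : ℝ, (-(Complex.I * s)) ^ j * θ.ft s * Complex.exp (-(Complex.I * x * s)) := by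
  have hpi : (Real.pi : ℂ) ≠ 0 := by exact_mod_cast Real.pi_ne_zero
  have h := Real.iteratedDeriv_fourier (f := ((𝓕⁻ θ.toSchwartz : 𝓢(ℝ, ℂ)) : ℝ → ℂ))
    (N := ⊤) (n := j) (fun n _ => by
      refine ((𝓕⁻ θ.toSchwartz).integrable_pow_mul volume n).mono'
        (by have := (𝓕⁻ θ.toSchwartz).continuous; fun_prop) (Eventually.of_forall fun s => ?_)
      simp) le_top
  rw [fourier_fourierInv_apply, h, Real.fourier_eq']
  have h2 := integral_comp_two_pi (fun t => Complex.exp (↑(-2 * Real.pi * inner ℝ t x) * Complex.I) •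
      (-2 * ↑Real.pi * Complex.I * ↑t) ^ j • (𝓕⁻ θ.toSchwartz) t)
  rw [eq_inv_mul_iff_mul_eq₀ (by simp [hpi]), ← h2]
  refine integral_congr_ae (Eventually.of_forall fun s => ?_)
  simp only [smul_eq_mul, ← ft_eq_fourierInv]
  have e1 : (-2 * ↑Real.pi * Complex.I * ↑(s / (2 * Real.pi)) : ℂ) = -(Complex.I * s) := by
    push_cast; field_simp
  have e2 : (↑(-2 * Real.pi * inner ℝ (s / (2 * Real.pi)) x) * Complex.I : ℂ) =
      -(Complex.I * x * s) := by
    simp; field_simp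
  rw [e1, e2]
  ring

theorem eq_integral_ft (θ : TestFn) (x : ℝ) :
    θ x = (2 * Real.pi : ℂ)⁻¹ * ∫ s : ℝ, θ.ft s * Complex.exp (-(Complex.I * x * s)) := by
  have := θ.iteratedDeriv_eq_integral 0 x
  simpa using this

theorem conj_ft (θ : TestFn) (s : ℝ) :
    ∫ x : ℝ, Complex.exp (-(Complex.I * x * s)) * conj (θ x) = conj (θ.ft s) := by
  rw [ft, ← integral_conj]
  refine integral_congr_ae (Eventually.of_forall fun x => ?_)
  simp [← Complex.exp_conj]

/-- The product of a test function with a smooth function. -/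
def mulSmooth (θ : TestFn) (g : ℝ → ℂ) (hg : ContDiff ℝ (⊤ : ℕ∞) g) : TestFn where
  toFun x := g x * θ x
  contDiff' := hg.mul θ.contDiff
  hasCompactSupport' := θ.hasCompactSupport.mul_left
  tsupport_subset' := subset_univ _

/-- The product of two test functions. -/
def mul (η θ : TestFn) : TestFn := θ.mulSmooth η η.contDiff

@[simp] theorem mul_apply (η θ : TestFn) (x : ℝ) : η.mul θ x = η x * θ x := rfl

/-- `x ↦ exp(-i x t) θ(x)`. -/
def modulate (θ : TestFn) (t : ℝ) : TestFn :=
  θ.mulSmooth (fun x => Complex.exp (-(Complex.I * x * t))) (by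
    have : ContDiff ℝ (⊤ : ℕ∞) (fun x : ℝ => (x : ℂ)) := Complex.ofRealCLM.contDiff
    fun_prop)

@[simp] theorem modulate_apply (θ : TestFn) (t x : ℝ) :
    θ.modulate t x = Complex.exp (-(Complex.I * x * t)) * θ x := rfl

/-- `x ↦ θ(x - a)`. -/
def translate (θ : TestFn) (a : ℝ) : TestFn where
  toFun x := θ (x - a)
  contDiff' := θ.contDiff.comp (contDiff_id.sub contDiff_const)
  hasCompactSupport' := θ.hasCompactSupport.comp_homeomorph (Homeomorph.subRight a)
  tsupport_subset' := subset_univ _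

@[simp] theorem translate_apply (θ : TestFn) (a x : ℝ) : θ.translate a x = θ (x - a) := rfl

/-- `x ↦ θ(c x)`. -/
def dilate (θ : TestFn) (c : ℝ) (hc : c ≠ 0) : TestFn where
  toFun x := θ (c * x)
  contDiff' := θ.contDiff.comp (contDiff_const.mul contDiff_id)
  hasCompactSupport' := θ.hasCompactSupport.comp_homeomorph (Homeomorph.mulLeft₀ c hc)
  tsupport_subset' := subset_univ _

@[simp] theorem dilate_apply (θ : TestFn) (c : ℝ) (hc : c ≠ 0) (x : ℝ) :
    θ.dilate c hc x = θ (c * x) := rfl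

@[simp] theorem conjugate_apply (θ : TestFn) (x : ℝ) : θ.conjugate x = conj (θ x) := rfl

theorem corr_apply (f g : TestFn) (x : ℝ) : f.corr g x = ∫ y : ℝ, f (x + y) * g y := rfl

theorem ft_modulate (θ : TestFn) (t s : ℝ) : (θ.modulate t).ft s = θ.ft (s - t) := by
  refine integral_congr_ae (Eventually.of_forall fun x => ?_)
  simp only [modulate_apply, ← mul_assoc, ← Complex.exp_add]
  congr 2
  push_cast
  ring

theorem ft_translate (θ : TestFn) (a s : ℝ) :
    (θ.translate a).ft s = Complex.exp (Complex.I * a * s) * θ.ft s := by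
  rw [ft, ft, ← integral_const_mul, ← integral_add_right_eq_self _ a]
  refine integral_congr_ae (Eventually.of_forall fun x => ?_)
  simp only [translate_apply, ← mul_assoc, ← Complex.exp_add, add_sub_cancel_right]
  congr 2
  push_cast
  ring

theorem ft_add (f g : TestFn) (s : ℝ) : (f + g).ft s = f.ft s + g.ft s := by
  simp [← ftS_apply, ftS, show (f + g).toSchwartz = f.toSchwartz + g.toSchwartz from rfl,
    FourierTransform.fourierInv_add]

theorem ft_smul (c : ℂ) (f : TestFn) (s : ℝ) : (c • f).ft s = c * f.ft s := by
  simp [← ftS_apply, ftS, show (c • f).toSchwartz = c • f.toSchwartz from rfl,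
    FourierTransform.fourierInv_smul]

theorem ft_sub (f g : TestFn) (s : ℝ) : (f - g).ft s = f.ft s - g.ft s := by
  rw [sub_eq_add_neg, ft_add, show -g = (-1 : ℂ) • g by simp, ft_smul]
  ring

/-- By Fubini and translation invariance, correlation with the conjugate becomes multiplication by
the conjugate transform. This is the source of all positivity below. -/
theorem ft_corr (f : TestFn) (s : ℝ) :
    (f.corr f.conjugate).ft s = ((‖f.ft s‖ ^ 2 : ℝ) : ℂ) := by
  have hint : Integrable (fun p : ℝ × ℝ => f (p.1 + p.2) * conj (f p.2)) := by
    have h := f.integrable.mul_prod f.conjugate.integrable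
    -- The shear `(x, y) ↦ (x + y, y)` preserves Lebesgue measure.
    have hmp := Measure.measurePreserving_swap.comp
      (measurePreserving_prod_add_swap (volume : Measure ℝ) (volume : Measure ℝ))
    refine (hmp.integrable_comp_of_integrable h).congr (Eventually.of_forall fun p => ?_)
    simp [add_comm]
  have hint2 : Integrable (Function.uncurry fun x y : ℝ =>
      Complex.exp (Complex.I * x * s) * (f (x + y) * conj (f y))) := by
    refine hint.bdd_mul (c := 1) (f := fun p : ℝ × ℝ => Complex.exp (Complex.I * p.1 * s)) ?_ ?_
    · exact Continuous.aestronglyMeasurable (by fun_prop)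
    · refine Eventually.of_forall fun p => ?_
      rw [Complex.norm_exp]
      simp
  calc (f.corr f.conjugate).ft s
      = ∫ x : ℝ, ∫ y : ℝ, Complex.exp (Complex.I * x * s) * (f (x + y) * conj (f y)) := by
        refine integral_congr_ae (Eventually.of_forall fun x => ?_)
        simp only [corr_apply, conjugate_apply, integral_const_mul]
    _ = ∫ y : ℝ, ∫ x : ℝ, Complex.exp (Complex.I * x * s) * (f (x + y) * conj (f y)) :=
        integral_integral_swap hint2
    _ = ∫ y : ℝ, f.ft s * (Complex.exp (-(Complex.I * y * s)) * conj (f y)) := by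
        refine integral_congr_ae (Eventually.of_forall fun y => ?_)
        dsimp only
        rw [← integral_sub_right_eq_self _ y, ft, ← integral_mul_const]
        refine integral_congr_ae (Eventually.of_forall fun x => ?_)
        dsimp only
        have : Complex.exp (Complex.I * ↑(x - y) * s) =
            Complex.exp (Complex.I * x * s) * Complex.exp (-(Complex.I * y * s)) := by
          rw [← Complex.exp_add]; congr 1; push_cast; ring
        rw [this, sub_add_cancel]
        ring
    _ = ((‖f.ft s‖ ^ 2 : ℝ) : ℂ) := by
        rw [integral_const_mul, conj_ft, Complex.mul_conj, Complex.normSq_eq_norm_sq]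

theorem memLp_two (f : TestFn) : MemLp (f : ℝ → ℂ) 2 volume :=
  f.contDiff.continuous.memLp_of_hasCompactSupport f.hasCompactSupport

theorem coeFn_toL2 (f : TestFn) : (f.toL2 : ℝ → ℂ) =ᵐ[volume] f := f.memLp_two.coeFn_toLp

theorem norm_toL2_sq (f : TestFn) : ‖f.toL2‖ ^ 2 = ∫ x, ‖f x‖ ^ 2 := norm_toLp_two_sq f.memLp_two

theorem corr_conjugate_zero (f : TestFn) :
    (f.corr f.conjugate) 0 = ((‖f.toL2‖ ^ 2 : ℝ) : ℂ) := by
  rw [norm_toL2_sq, ← integral_complex_ofReal, corr_apply]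
  refine integral_congr_ae (Eventually.of_forall fun x => ?_)
  simp [Complex.mul_conj, Complex.normSq_eq_norm_sq]

theorem toL2_eq_toLp (f : TestFn) : f.toL2 = f.toSchwartz.toLp 2 := by
  refine Lp.ext ?_
  filter_upwards [f.coeFn_toL2, f.toSchwartz.coeFn_toLp 2 volume] with x h1 h2
  rw [h1, h2]
  rfl

theorem toL2_sub (f g : TestFn) : (f - g).toL2 = f.toL2 - g.toL2 := by
  refine Lp.ext ?_
  filter_upwards [f.coeFn_toL2, g.coeFn_toL2, (f - g).coeFn_toL2,
    Lp.coeFn_sub f.toL2 g.toL2] with x h1 h2 h3 h4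
  rw [h3, h4, Pi.sub_apply, h1, h2]
  rfl

end TestFn

/-! ### The unitary Fourier transform on `L²(ℝ)` -/

theorem quasiMeasurePreserving_div_two_pi :
    Measure.QuasiMeasurePreserving (fun s : ℝ => s / (2 * Real.pi)) volume volume := by
  refine ⟨by fun_prop, ?_⟩
  have : (fun s : ℝ => s / (2 * Real.pi)) = fun s => s * (2 * Real.pi)⁻¹ :=
    funext fun s => div_eq_mul_inv _ _
  rw [this, Real.map_volume_mul_right (by positivity)]
  exact Measure.smul_absolutelyContinuous

theorem lintegral_comp_div_two_pi (g : ℝ → ℝ≥0∞) :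
    ∫⁻ s : ℝ, g (s / (2 * Real.pi)) = ENNReal.ofReal (2 * Real.pi) * ∫⁻ t, g t := by
  have h := Real.map_volume_mul_right (a := (2 * Real.pi)⁻¹) (by positivity)
  have e : MeasurableEmbedding (fun s : ℝ => s * (2 * Real.pi)⁻¹) :=
    (Homeomorph.mulRight₀ (2 * Real.pi)⁻¹ (by positivity)).measurableEmbedding
  calc ∫⁻ s : ℝ, g (s / (2 * Real.pi))
      = ∫⁻ s : ℝ, g (s * (2 * Real.pi)⁻¹) := by simp only [div_eq_mul_inv]
    _ = ∫⁻ t, g t ∂(Measure.map (fun s : ℝ => s * (2 * Real.pi)⁻¹) volume) :=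
        (e.lintegral_map _).symm
    _ = _ := by rw [h, lintegral_smul_measure, inv_inv, abs_of_pos Real.two_pi_pos, smul_eq_mul]

theorem aestronglyMeasurable_hatL2 (f : Lp ℂ 2 (volume : Measure ℝ)) :
    AEStronglyMeasurable (hatL2 f) volume :=
  ((Lp.aestronglyMeasurable _).comp_quasiMeasurePreserving
    quasiMeasurePreserving_div_two_pi).const_mul _

theorem hatL2_sub (f g : Lp ℂ 2 (volume : Measure ℝ)) :
    hatL2 (f - g) =ᵐ[volume] fun s => hatL2 f s - hatL2 g s := by
  have h : (𝓕⁻ (f - g) : Lp ℂ 2 (volume : Measure ℝ)) = 𝓕⁻ f - 𝓕⁻ g :=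
    map_sub (Lp.fourierTransformₗᵢ ℝ ℂ).symm f g
  have h2 := quasiMeasurePreserving_div_two_pi.ae
    (Lp.coeFn_sub (𝓕⁻ f : Lp ℂ 2 (volume : Measure ℝ)) (𝓕⁻ g))
  filter_upwards [h2] with s hs
  rw [hatL2, h, hs, hatL2, hatL2, Pi.sub_apply, mul_sub]

theorem hatL2_zero : hatL2 0 =ᵐ[volume] fun _ => 0 := by
  have := hatL2_sub 0 0
  simpa using this

theorem lintegral_hatL2 (f : Lp ℂ 2 (volume : Measure ℝ)) :
    ∫⁻ s, ‖hatL2 f s‖ₑ ^ 2 = ‖f‖ₑ ^ 2 := by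
  have h1 : ‖(𝓕⁻ f : Lp ℂ 2 (volume : Measure ℝ))‖ = ‖f‖ :=
    (Lp.fourierTransformₗᵢ ℝ ℂ).symm.norm_map f
  have h2 : ∫⁻ t, ‖(𝓕⁻ f : Lp ℂ 2 (volume : Measure ℝ)) t‖ₑ ^ 2 = ‖f‖ₑ ^ 2 := by
    rw [← enorm_norm f, ← h1, enorm_norm, Lp.enorm_def, eLpNorm_eq_lintegral_rpow_enorm_toReal
      two_ne_zero ENNReal.ofNat_ne_top, ← ENNReal.rpow_natCast, ← ENNReal.rpow_mul]
    simp
  have h3 : ‖((Real.sqrt (2 * Real.pi) : ℝ) : ℂ)⁻¹‖ₑ ^ 2 = (ENNReal.ofReal (2 * Real.pi))⁻¹ := by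
    rw [← ofReal_norm, ← ENNReal.ofReal_pow (norm_nonneg _),
      ← ENNReal.ofReal_inv_of_pos Real.two_pi_pos]
    congr 1
    simp only [norm_inv, Complex.norm_real, Real.norm_eq_abs, inv_pow, sq_abs]
    rw [Real.sq_sqrt Real.two_pi_pos.le]
  simp only [hatL2, enorm_mul, mul_pow, h3]
  rw [lintegral_const_mul' _ _ (by simp [Real.pi_pos]),
    lintegral_comp_div_two_pi fun t => ‖(𝓕⁻ f : Lp ℂ 2 (volume : Measure ℝ)) t‖ₑ ^ 2, h2,
    ← mul_assoc, ENNReal.inv_mul_cancel (by simp [Real.pi_pos]) ENNReal.ofReal_ne_top, one_mul]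

namespace TestFn

/-- The unitary Fourier transform of a test function. -/
def hat (f : TestFn) (s : ℝ) : ℂ := ((Real.sqrt (2 * Real.pi) : ℝ) : ℂ)⁻¹ * f.ft s

theorem hat_sub (f g : TestFn) (s : ℝ) : (f - g).hat s = f.hat s - g.hat s := by
  rw [hat, ft_sub, mul_sub, hat, hat]

theorem continuous_hat (f : TestFn) : Continuous f.hat := continuous_const.mul f.continuous_ft

theorem norm_hat_sq (f : TestFn) (s : ℝ) : ‖f.hat s‖ ^ 2 = (2 * Real.pi)⁻¹ * ‖f.ft s‖ ^ 2 := by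
  rw [hat, norm_mul, mul_pow, norm_inv, Complex.norm_real, inv_pow, Real.norm_eq_abs, sq_abs,
    Real.sq_sqrt Real.two_pi_pos.le]

theorem hatL2_toL2 (f : TestFn) : hatL2 f.toL2 =ᵐ[volume] f.hat := by
  have h : (𝓕⁻ f.toL2 : Lp ℂ 2 (volume : Measure ℝ)) = (𝓕⁻ f.toSchwartz).toLp 2 := by
    rw [toL2_eq_toLp]
    exact SchwartzMap.toLp_fourierInv_eq _
  have h2 := quasiMeasurePreserving_div_two_pi.ae ((𝓕⁻ f.toSchwartz).coeFn_toLp 2 volume)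
  filter_upwards [h2] with s hs
  rw [hatL2, h, hs, hat, ft_eq_fourierInv]

end TestFn

/-! ### Local structure of distributions -/

/-- A linear functional bounded by `‖D x‖`, where `D` maps to a Hilbert space, factors through `D`
as an inner product. -/
theorem exists_inner_eq_of_norm_le {X H : Type*} [AddCommGroup X] [Module ℂ X]
    [NormedAddCommGroup H] [InnerProductSpace ℂ H] [CompleteSpace H]
    (D : X →ₗ[ℂ] H) (W : X →ₗ[ℂ] ℂ) (C : ℝ) (h : ∀ x, ‖W x‖ ≤ C * ‖D x‖) :
    ∃ g : H, ∀ x, W x = inner ℂ g (D x) := by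
  let T := (LinearMap.range D).topologicalClosure
  let e : X →ₗ[ℂ] T := D.codRestrict T fun x =>
    Submodule.le_topologicalClosure _ (LinearMap.mem_range_self D x)
  have he : DenseRange e := by
    intro y
    rw [Topology.IsInducing.subtypeVal.closure_eq_preimage_closure_image]
    have : (Subtype.val '' Set.range e : Set H) = (LinearMap.range D : Set H) := by
      rw [← Set.range_comp]; rfl
    rw [Set.mem_preimage]
    erw [this]
    exact y.2
  have : CompleteSpace T := (Submodule.isClosed_topologicalClosure _).completeSpace_coe
  -- The bound makes `W` depend on `D x` only and continuously, so it extends to the closed range of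
  -- `D`, a Hilbert space where Riesz representation applies.
  let V : T →L[ℂ] ℂ := W.extendOfNorm e
  refine ⟨((InnerProductSpace.toDual ℂ T).symm V : T), fun x => ?_⟩
  have h1 : V (e x) = W x := LinearMap.extendOfNorm_eq he ⟨C, h⟩ x
  rw [← h1, ← InnerProductSpace.toDual_symm_apply (𝕜 := ℂ) (E := T)]
  rfl

theorem norm_le_of_norm_deriv_le {f : ℝ → ℂ} {R C : ℝ} (hR : 0 ≤ R) (hC : 0 ≤ C)
    (hf : ContDiff ℝ 1 f)
    (hsupp : ∀ x, x ∉ Icc (-R) R → f x = 0) (hd : ∀ x, ‖deriv f x‖ ≤ C) (x : ℝ) :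
    ‖f x‖ ≤ C * (2 * R + 1) := by
  by_cases hx : x ∈ Icc (-R) R
  · have h := Convex.norm_image_sub_le_of_norm_deriv_le (s := univ) (f := f) (C := C)
      (fun y _ => (hf.differentiable (by norm_num)).differentiableAt) (fun y _ => hd y) convex_univ
      (mem_univ (-R - 1)) (mem_univ x)
    rw [hsupp (-R - 1) (by simp), sub_zero] at h
    refine h.trans (mul_le_mul_of_nonneg_left ?_ hC)
    rw [Real.norm_eq_abs, abs_of_nonneg (by linarith [hx.1])]
    linarith [hx.2]
  · rw [hsupp x hx, norm_zero]; positivity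

/-- Integrate the derivative from the left endpoint and apply Cauchy-Schwarz on an interval of
length `2R`. -/
theorem norm_le_of_deriv_L2 {f : ℝ → ℂ} {R : ℝ} 
    (hf : ContDiff ℝ 1 f)
    (hsupp : ∀ x, x ∉ Icc (-R) R → f x = 0) (x : ℝ) :
    ‖f x‖ ≤ Real.sqrt (2 * R) * Real.sqrt (∫ y, ‖deriv f y‖ ^ 2) := by
  by_cases hx : x ∈ Icc (-R) R
  swap
  · rw [hsupp x hx, norm_zero]; positivity
  have hR : 0 ≤ R := by linarith [hx.1, hx.2]
  have hcd : Continuous (deriv f) := hf.continuous_deriv le_rfl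
  have hends : f (-R) = 0 := by
    have hcl : (-R) ∈ closure (Iio (-R)) := by rw [closure_Iio]; exact self_mem_Iic
    exact (isClosed_singleton.preimage hf.continuous).closure_subset_iff.2
      (fun y (hy : y < -R) => hsupp y fun h => absurd h.1 (not_le.2 hy)) hcl
  have h1 : ∫ y in (-R)..x, deriv f y = f x := by
    rw [intervalIntegral.integral_deriv_eq_sub
      (fun y _ => (hf.differentiable (by norm_num)).differentiableAt)
      (hcd.intervalIntegrable _ _), hends, sub_zero]
  have hzero : ∀ y ∉ Icc (-R) R, deriv f y = 0 := fun y hy => by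
    have h : f =ᶠ[𝓝 y] fun _ => 0 := by
      filter_upwards [isClosed_Icc.isOpen_compl.mem_nhds hy] with z hz using hsupp z hz
    rw [h.deriv_eq]; simp
  have h2 : ∫ y, ‖deriv f y‖ ^ 2 = ∫ y in Icc (-R) R, ‖deriv f y‖ ^ 2 :=
    (setIntegral_eq_integral_of_forall_compl_eq_zero fun y hy => by simp [hzero y hy]).symm
  have hio : IntegrableOn (fun y => ‖deriv f y‖) (Icc (-R) R) :=
    hcd.norm.continuousOn.integrableOn_Icc
  have hmem : MemLp (fun y => ‖deriv f y‖) 2 (volume.restrict (Icc (-R) R)) := by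
    rw [memLp_two_iff_integrable_sq hcd.norm.aestronglyMeasurable]
    exact (hcd.norm.pow 2).continuousOn.integrableOn_Icc
  have h3 := integral_mul_le_Lp_mul_Lq_of_nonneg (μ := volume.restrict (Icc (-R) R))
    (p := 2) (q := 2) Real.HolderConjugate.two_two (f := fun _ => (1 : ℝ))
    (g := fun y => ‖deriv f y‖) (Eventually.of_forall fun _ => zero_le_one)
    (Eventually.of_forall fun _ => norm_nonneg _) (memLp_const _) (by simpa using hmem)
  simp only [one_mul, Real.rpow_ofNat, ← Real.sqrt_eq_rpow] at h3
  rw [setIntegral_const, smul_eq_mul, one_pow, mul_one, Real.volume_real_Icc_of_le (by linarith),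
    ← h2, show R - -R = 2 * R by ring] at h3
  refine le_trans ?_ h3
  rw [← h1]
  refine (intervalIntegral.norm_integral_le_integral_norm hx.1).trans ?_
  rw [intervalIntegral.integral_of_le hx.1]
  exact setIntegral_mono_set hio (Eventually.of_forall fun _ => norm_nonneg _)
    (Ioc_subset_Icc_self.trans (Icc_subset_Icc_right hx.2)).eventuallyLE

theorem iteratedDeriv_eq_zero_of_notMem {f : ℝ → ℂ} {R : ℝ}
    (hsupp : ∀ x, x ∉ Icc (-R) R → f x = 0) (j : ℕ) (x : ℝ) (hx : x ∉ Icc (-R) R) :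
    iteratedDeriv j f x = 0 := by
  have h : f =ᶠ[𝓝 x] fun _ => 0 := by
    filter_upwards [isClosed_Icc.isOpen_compl.mem_nhds hx] with y hy using hsupp y hy
  rw [h.iteratedDeriv_eq]
  simp

/-- One Cauchy-Schwarz step at the top order and `i` mean value steps below it, each costing at most
a factor `2R + 1`. Sup norms of several orders are thus controlled by a single Hilbert space norm.
-/
theorem norm_iteratedDeriv_le_of_L2 {f : ℝ → ℂ} {R : ℝ} (hR : 0 ≤ R)
    (hf : ContDiff ℝ (⊤ : ℕ∞) f) (hsupp : ∀ x, x ∉ Icc (-R) R → f x = 0) (i j : ℕ) (x : ℝ) :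
    ‖iteratedDeriv j f x‖ ≤
      (2 * R + 1) ^ (i + 1) * Real.sqrt (∫ y, ‖iteratedDeriv (i + j + 1) f y‖ ^ 2) := by
  have hsm (l : ℕ) : ContDiff ℝ 1 (iteratedDeriv l f) :=
    (iteratedDeriv_eq_iterate (f := f) (n := l) ▸ hf.iterate_deriv l).of_le (by exact_mod_cast le_top)
  induction i generalizing j x with
  | zero =>
    have h := norm_le_of_deriv_L2 (hsm j) (iteratedDeriv_eq_zero_of_notMem hsupp j) x
    rw [← iteratedDeriv_succ] at h
    rw [zero_add, zero_add, pow_one]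
    refine h.trans (mul_le_mul_of_nonneg_right ?_ (Real.sqrt_nonneg _))
    rw [Real.sqrt_le_left (by positivity)]
    nlinarith
  | succ i ih =>
    have h := norm_le_of_norm_deriv_le hR
      (C := (2 * R + 1) ^ (i + 1) * Real.sqrt (∫ y, ‖iteratedDeriv (i + (j + 1) + 1) f y‖ ^ 2))
      (by positivity) (hsm j)
      (iteratedDeriv_eq_zero_of_notMem hsupp j) (fun y => by
        rw [← iteratedDeriv_succ]; exact ih (j + 1) y) x
    rw [show i + 1 + j + 1 = i + (j + 1) + 1 by ring, pow_succ _ (i + 1)]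
    refine h.trans (le_of_eq (by ring))

namespace AntiDistribution

/-- On functions supported in a fixed interval, a distribution is a derivative of an integrable
function. -/
theorem exists_eq_integral_iteratedDeriv (w : AntiDistribution) (R : ℝ) (hR : 0 ≤ R) :
    ∃ (m : ℕ) (g : ℝ → ℂ), Integrable g ∧ ∀ f : TestFn, (∀ x, x ∉ Icc (-R) R → f x = 0) →
      w f = ∫ x, conj (iteratedDeriv m f x) * g x := by
  let K : TopologicalSpace.Compacts ℝ := ⟨Icc (-R) R, isCompact_Icc⟩
  let incl : 𝓓_{K}(ℝ, ℂ) → TestFn := TestFunction.ofSupportedIn (Set.subset_univ _)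
  have hincl : Continuous incl := TestFunction.continuous_ofSupportedIn _
  -- The conjugate turns the antilinear functional into a linear one.
  let W : 𝓓_{K}(ℝ, ℂ) →ₗ[ℂ] ℂ :=
    { toFun := fun f => conj (w (incl f))
      map_add' := fun f g => by
        rw [show incl (f + g) = incl f + incl g from rfl]; simp
      map_smul' := fun c f => by
        rw [show incl (c • f) = c • incl f from rfl]; simp }
  have hW : Continuous W := Complex.continuous_conj.comp (w.continuous.comp hincl)
  obtain ⟨s, C, -, hC⟩ := Seminorm.bound_of_continuous
    (ContDiffMapSupportedIn.withSeminorms ℂ ℝ ℂ ⊤ K) ((normSeminorm ℂ ℂ).comp W) hW.norm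
  obtain ⟨N, hN⟩ : ∃ N, ∀ i ∈ s, i ≤ N := ⟨s.sup id, fun i hi => Finset.le_sup (f := id) hi⟩
  -- One derivative more than any seminorm in the bound, since passing from `L²` to the sup norm
  -- costs one.
  set m := N + 1
  have hsupp (f : 𝓓_{K}(ℝ, ℂ)) (x : ℝ) (hx : x ∉ Icc (-R) R) : f x = 0 := f.zero_on_compl hx
  have hcont (f : 𝓓_{K}(ℝ, ℂ)) : Continuous (iteratedDeriv m f) :=
    f.contDiff.continuous_iteratedDeriv m (by exact_mod_cast le_top)
  have hmem (f : 𝓓_{K}(ℝ, ℂ)) : MemLp (iteratedDeriv m f) 2 (volume : Measure ℝ) :=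
    (hcont f).memLp_of_hasCompactSupport (HasCompactSupport.intro isCompact_Icc
      (iteratedDeriv_eq_zero_of_notMem (hsupp f) m))
  have hcda (f : 𝓓_{K}(ℝ, ℂ)) (x : ℝ) : ContDiffAt ℝ m f x :=
    (f.contDiff.of_le (by exact_mod_cast le_top)).contDiffAt
  let D : 𝓓_{K}(ℝ, ℂ) →ₗ[ℂ] Lp ℂ 2 (volume : Measure ℝ) :=
    { toFun := fun f => (hmem f).toLp _
      map_add' := fun f g => by
        rw [← MemLp.toLp_add]
        refine MemLp.toLp_congr _ _ (Eventually.of_forall fun x => ?_)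
        exact iteratedDeriv_add (hcda f x) (hcda g x)
      map_smul' := fun c f => by
        rw [RingHom.id_apply, ← MemLp.toLp_const_smul]
        refine MemLp.toLp_congr _ _ (Eventually.of_forall fun x => ?_)
        exact iteratedDeriv_const_smul_field c _ }
  have hD (f : 𝓓_{K}(ℝ, ℂ)) : ‖D f‖ = Real.sqrt (∫ y, ‖iteratedDeriv m f y‖ ^ 2) := by
    rw [← norm_toLp_two_sq (hmem f), Real.sqrt_sq (norm_nonneg _)]
    rfl
  have hsem (f : 𝓓_{K}(ℝ, ℂ)) (i : ℕ) (hi : i ∈ s) :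
      ContDiffMapSupportedIn.seminorm ℂ ℝ ℂ ⊤ K i f ≤ (2 * R + 1) ^ (N + 1) * ‖D f‖ := by
    rw [ContDiffMapSupportedIn.seminorm_top_le_iff ℂ (by positivity)]
    intro x _
    rw [norm_iteratedFDeriv_eq_norm_iteratedDeriv, hD]
    have h := norm_iteratedDeriv_le_of_L2 hR f.contDiff (hsupp f) (N - i) i x
    rw [show N - i + i + 1 = m by have := hN i hi; omega] at h
    refine h.trans (mul_le_mul_of_nonneg_right ?_ (Real.sqrt_nonneg _))
    exact pow_le_pow_right₀ (by linarith) (by omega)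
  obtain ⟨g, hg⟩ := exists_inner_eq_of_norm_le D W (C * (2 * R + 1) ^ (N + 1)) (fun f => by
    refine (hC f).trans ?_
    rw [smul_apply, NNReal.smul_def, smul_eq_mul, mul_assoc]
    refine mul_le_mul_of_nonneg_left ?_ C.2
    exact Seminorm.finset_sup_apply_le (by positivity) (hsem f))
  -- The Riesz vector is only square integrable; cutting it to the interval makes it integrable and
  -- changes no pairing with functions supported there.
  refine ⟨m, (Icc (-R) R).indicator g, ?_, fun f hf => ?_⟩
  · rw [integrable_indicator_iff measurableSet_Icc]
    exact ((Lp.memLp g).restrict _).integrable (by norm_num)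
  · let f' : 𝓓_{K}(ℝ, ℂ) := ⟨f, f.contDiff, fun x hx => hf x hx⟩
    have h1 : W f' = conj (w f) := rfl
    have h2 := congrArg conj (hg f')
    rw [h1, Complex.conj_conj, inner_conj_symm, L2.inner_def] at h2
    rw [h2]
    refine integral_congr_ae ?_
    filter_upwards [(hmem f').coeFn_toLp] with x hx
    rw [RCLike.inner_apply]
    change _ * conj ((hmem f').toLp _ x) = _
    rw [hx]
    change _ * conj (iteratedDeriv m f x) = _
    by_cases hxK : x ∈ Icc (-R) R
    · rw [indicator_of_mem hxK, mul_comm]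
    · rw [iteratedDeriv_eq_zero_of_notMem hf m x hxK]; simp

end AntiDistribution

/-! ### Fourier transforms of localized distributions -/

theorem iteratedDeriv_exp_neg (t : ℝ) (j : ℕ) (x : ℝ) :
    iteratedDeriv j (fun x : ℝ => Complex.exp (-(Complex.I * x * t))) x =
      (-(Complex.I * t)) ^ j * Complex.exp (-(Complex.I * x * t)) := by
  induction j generalizing x with
  | zero => simp
  | succ j ih =>
    rw [iteratedDeriv_succ, funext ih]
    have h : HasDerivAt (fun x : ℝ => (-(Complex.I * t)) ^ j * Complex.exp (-(Complex.I * x * t)))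
        ((-(Complex.I * t)) ^ j * (Complex.exp (-(Complex.I * x * t)) *
          (-(Complex.I * 1 * t)))) x :=
      ((((Complex.ofRealCLM.hasDerivAt (x := x)).const_mul Complex.I).mul_const
        (t : ℂ)).neg.cexp).const_mul _
    rw [h.deriv]
    ring

namespace TestFn

theorem continuous_iteratedDeriv' (θ : TestFn) (j : ℕ) : Continuous (iteratedDeriv j θ) :=
  θ.contDiff.continuous_iteratedDeriv j (by exact_mod_cast le_top)

theorem exists_support_subset (θ : TestFn) : ∃ R : ℝ, 0 ≤ R ∧ ∀ x, x ∉ Icc (-R) R → θ x = 0 := by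
  obtain ⟨R, hR⟩ := θ.hasCompactSupport.isCompact.isBounded.subset_closedBall 0
  refine ⟨max R 0, le_max_right _ _, fun x hx => ?_⟩
  by_contra h
  have h2 := hR (subset_tsupport _ h)
  rw [Real.closedBall_eq_Icc] at h2
  refine hx ⟨?_, ?_⟩
  · have := h2.1; have := le_max_left R 0; linarith
  · have := h2.2; have := le_max_left R 0; linarith

theorem exists_norm_iteratedDeriv_le (θ : TestFn) (j : ℕ) :
    ∃ C : ℝ, 0 ≤ C ∧ ∀ x, ‖iteratedDeriv j θ x‖ ≤ C := by
  obtain ⟨R, -, hR⟩ := θ.exists_support_subset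
  obtain ⟨C, hC⟩ := (θ.continuous_iteratedDeriv' j).bounded_above_of_compact_support
    (HasCompactSupport.intro isCompact_Icc (iteratedDeriv_eq_zero_of_notMem hR j))
  exact ⟨C, (norm_nonneg _).trans (hC 0), hC⟩

/-- The weights in the expansion of a distribution applied to a product with `κ`. -/
def weight (κ : TestFn) (g : ℝ → ℂ) (i : ℕ) (x : ℝ) : ℂ := conj (iteratedDeriv i κ x) * g x

theorem integrable_weight (κ : TestFn) {g : ℝ → ℂ} (hg : Integrable g) (i : ℕ) :
    Integrable (κ.weight g i) := by
  obtain ⟨C, -, hC⟩ := κ.exists_norm_iteratedDeriv_le i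
  refine hg.bdd_mul (c := C) ?_ (Eventually.of_forall fun x => ?_)
  · exact (Complex.continuous_conj.comp (κ.continuous_iteratedDeriv' i)).aestronglyMeasurable
  · simpa using hC x

end TestFn

/-- Leibniz' rule, with the derivatives of `κ` moved into integrable weights. For `f` an
exponential, the remaining derivatives are powers of the frequency. -/
theorem integral_conj_iteratedDeriv_mulSmooth {m : ℕ} {g : ℝ → ℂ} (hg : Integrable g)
    (κ : TestFn) (f : ℝ → ℂ) (hf : ContDiff ℝ (⊤ : ℕ∞) f) :
    ∫ x, conj (iteratedDeriv m (κ.mulSmooth f hf) x) * g x =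
      ∑ j ∈ Finset.range (m + 1), (m.choose j : ℂ) *
        ∫ x, conj (iteratedDeriv j f x) * κ.weight g (m - j) x := by
  obtain ⟨R, -, hR⟩ := κ.exists_support_subset
  have hint (j : ℕ) : Integrable fun x => conj (iteratedDeriv j f x) * κ.weight g (m - j) x := by
    have hc : Continuous (iteratedDeriv j f) :=
      hf.continuous_iteratedDeriv j (by exact_mod_cast le_top)
    have hc2 : Continuous fun x => iteratedDeriv j f x * iteratedDeriv (m - j) κ x :=
      hc.mul (κ.continuous_iteratedDeriv' _)
    obtain ⟨C, hC⟩ := hc2.bounded_above_of_compact_support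
      (HasCompactSupport.intro isCompact_Icc fun x hx => by
        rw [iteratedDeriv_eq_zero_of_notMem hR (m - j) x hx, mul_zero])
    refine (hg.bdd_mul (c := C) (Complex.continuous_conj.comp hc2).aestronglyMeasurable
      (Eventually.of_forall fun x => by simpa using hC x)).congr (Eventually.of_forall fun x => ?_)
    simp [TestFn.weight, mul_assoc]
  simp_rw [← integral_const_mul]
  rw [← integral_finsetSum _ fun j _ => (hint j).const_mul _]
  refine integral_congr_ae (Eventually.of_forall fun x => ?_)
  have h : iteratedDeriv m (κ.mulSmooth f hf) x = ∑ j ∈ Finset.range (m + 1),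
      m.choose j * iteratedDeriv j f x * iteratedDeriv (m - j) κ x :=
    iteratedDeriv_fun_mul (f := f) (g := κ)
      (hf.of_le (by exact_mod_cast le_top)).contDiffAt
      (κ.contDiff.of_le (by exact_mod_cast le_top)).contDiffAt
  dsimp only
  rw [h, map_sum, Finset.sum_mul]
  refine Finset.sum_congr rfl fun j _ => ?_
  simp only [TestFn.weight, map_mul, map_natCast]
  ring

theorem integral_conj_iteratedDeriv_modulate {m : ℕ} {g : ℝ → ℂ} (hg : Integrable g)
    (κ : TestFn) (t : ℝ) :
    ∫ x, conj (iteratedDeriv m (κ.modulate t) x) * g x =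
      ∑ j ∈ Finset.range (m + 1), (m.choose j : ℂ) * (Complex.I * t) ^ j *
        ∫ x : ℝ, Complex.exp (Complex.I * x * t) * κ.weight g (m - j) x := by
  rw [TestFn.modulate, integral_conj_iteratedDeriv_mulSmooth hg]
  refine Finset.sum_congr rfl fun j _ => ?_
  rw [mul_assoc, ← integral_const_mul ((Complex.I * (t : ℂ)) ^ j)]
  congr 1
  refine integral_congr_ae (Eventually.of_forall fun x => ?_)
  simp only [iteratedDeriv_exp_neg, map_mul, map_pow, map_neg, Complex.conj_I, Complex.conj_ofReal,
    ← Complex.exp_conj]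
  ring_nf

theorem continuous_integral_exp_mul {G : ℝ → ℂ} (hG : Integrable G) :
    Continuous fun t : ℝ => ∫ x : ℝ, Complex.exp (Complex.I * x * t) * G x := by
  refine continuous_of_dominated (bound := fun x => ‖G x‖) (fun t => ?_) (fun t => ?_) hG.norm ?_
  · exact (Continuous.aestronglyMeasurable (by fun_prop)).mul hG.1
  · refine Eventually.of_forall fun x => ?_
    rw [norm_mul, Complex.norm_exp]
    simp
  · exact Eventually.of_forall fun x => by fun_prop

theorem norm_integral_exp_mul_le {G : ℝ → ℂ} (t : ℝ) :
    ‖∫ x : ℝ, Complex.exp (Complex.I * x * t) * G x‖ ≤ ∫ x, ‖G x‖ := by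
  refine (norm_integral_le_integral_norm _).trans (le_of_eq ?_)
  congr 1 with x
  rw [norm_mul, Complex.norm_exp]
  simp

/-- Parseval's identity for integrable `G`: insert the inversion formula for the derivative and
exchange the integrals. -/
theorem integral_conj_iteratedDeriv_mul_eq {G : ℝ → ℂ} (hG : Integrable G) (θ : TestFn) (j : ℕ) :
    ∫ x, conj (iteratedDeriv j θ x) * G x = (2 * Real.pi : ℂ)⁻¹ *
      ∫ s : ℝ, conj (θ.ft s) * ((Complex.I * s) ^ j *
        ∫ x : ℝ, Complex.exp (Complex.I * x * s) * G x) := by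
  have hA : Integrable fun s : ℝ => conj (θ.ft s) * (Complex.I * s) ^ j := by
    have h := θ.integrable_pow_mul_ft j
    refine h.mono (by have := θ.continuous_ft; fun_prop) (Eventually.of_forall fun s => ?_)
    simp [mul_comm]
  have hint : Integrable (Function.uncurry fun x s : ℝ => Complex.exp (Complex.I * x * s) *
      (G x * (conj (θ.ft s) * (Complex.I * s) ^ j))) := by
    refine (hG.mul_prod hA).bdd_mul (c := 1)
      (f := fun p : ℝ × ℝ => Complex.exp (Complex.I * p.1 * p.2)) ?_ ?_
    · exact Continuous.aestronglyMeasurable (by fun_prop)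
    · refine Eventually.of_forall fun p => ?_
      rw [Complex.norm_exp]
      simp
  have h1 (x : ℝ) : conj (iteratedDeriv j θ x) * G x = (2 * Real.pi : ℂ)⁻¹ *
      ∫ s : ℝ, Complex.exp (Complex.I * x * s) *
        (G x * (conj (θ.ft s) * (Complex.I * s) ^ j)) := by
    rw [θ.iteratedDeriv_eq_integral, map_mul, ← integral_conj, mul_assoc, ← integral_mul_const]
    congr 1
    · simp [Complex.conj_ofNat]
    · refine integral_congr_ae (Eventually.of_forall fun s => ?_)
      simp only [map_mul, map_pow, map_neg, Complex.conj_I, Complex.conj_ofReal,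
        ← Complex.exp_conj]
      ring_nf
  simp_rw [h1]
  rw [integral_const_mul, integral_integral_swap hint]
  congr 1
  refine integral_congr_ae (Eventually.of_forall fun s => ?_)
  dsimp only
  rw [← mul_assoc, ← integral_const_mul]
  refine integral_congr_ae (Eventually.of_forall fun x => ?_)
  ring

namespace AntiDistribution

theorem continuous_apply_modulate (w : AntiDistribution) (κ : TestFn) :
    Continuous fun s => w (κ.modulate s) := by
  obtain ⟨R, hR, hκ⟩ := κ.exists_support_subset
  obtain ⟨m, g, hg, h⟩ := w.exists_eq_integral_iteratedDeriv R hR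
  have e (s : ℝ) := h (κ.modulate s) (fun x hx => by simp [hκ x hx])
  simp_rw [e, integral_conj_iteratedDeriv_modulate hg]
  refine continuous_finsetSum _ fun j _ => ?_
  have := continuous_integral_exp_mul (κ.integrable_weight hg (m - j))
  fun_prop

theorem integrable_conj_ft_mul_pow_mul {G : ℝ → ℂ} (hG : Integrable G) (θ : TestFn) (j : ℕ) :
    Integrable fun s : ℝ => conj (θ.ft s) * ((Complex.I * s) ^ j *
        ∫ x : ℝ, Complex.exp (Complex.I * x * s) * G x) := by
  have h1 := continuous_integral_exp_mul hG
  have h2 := θ.continuous_ft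
  refine ((θ.integrable_pow_mul_ft j).norm.mul_const (∫ x, ‖G x‖)).mono' (by fun_prop)
    (Eventually.of_forall fun s => ?_)
  rw [norm_mul, norm_mul, norm_mul, ← mul_assoc]
  refine mul_le_mul (le_of_eq ?_) (norm_integral_exp_mul_le s) (norm_nonneg _) (by positivity)
  simp [mul_comm]

/-- The distribution `κ w` is the Fourier transform of `s ↦ w(κ e_s)`. -/
theorem apply_mul_eq_integral (w : AntiDistribution) (κ θ : TestFn) :
    Integrable (fun s => conj (θ.ft s) * w (κ.modulate s)) ∧
    w (θ.mul κ) = (2 * Real.pi : ℂ)⁻¹ * ∫ s : ℝ, conj (θ.ft s) * w (κ.modulate s) := by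
  obtain ⟨R, hR, hκ⟩ := κ.exists_support_subset
  -- The interval depends on `κ` alone, so one pair `m`, `g` serves all modulations of `κ` and its
  -- product with `θ`. Both sides then expand by Leibniz into sums that agree term by term.
  obtain ⟨m, g, hg, h⟩ := w.exists_eq_integral_iteratedDeriv R hR
  have e (s : ℝ) : conj (θ.ft s) * w (κ.modulate s) = ∑ j ∈ Finset.range (m + 1),
      (m.choose j : ℂ) * (conj (θ.ft s) * ((Complex.I * s) ^ j *
        ∫ x : ℝ, Complex.exp (Complex.I * x * s) * κ.weight g (m - j) x)) := by
    rw [h (κ.modulate s) (fun x hx => by simp [hκ x hx]), integral_conj_iteratedDeriv_modulate hg,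
      Finset.mul_sum]
    exact Finset.sum_congr rfl fun j _ => by ring
  have hint (j : ℕ) := (integrable_conj_ft_mul_pow_mul
    (κ.integrable_weight hg (m - j)) θ j).const_mul (m.choose j : ℂ)
  simp_rw [e]
  refine ⟨integrable_finsetSum _ fun j _ => hint j, ?_⟩
  rw [integral_finsetSum _ fun j _ => hint j, h (θ.mul κ) (fun x hx => by simp [hκ x hx]),
    TestFn.mul, integral_conj_iteratedDeriv_mulSmooth hg, Finset.mul_sum]
  refine Finset.sum_congr rfl fun j _ => ?_
  rw [integral_const_mul, integral_conj_iteratedDeriv_mul_eq (κ.integrable_weight hg _)]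
  ring

end AntiDistribution

/-! ### Modulated autocorrelations and dilated cutoffs -/

namespace TestFn

/-- A bump function centered at the origin. -/
def realBump : ContDiffBump (0 : ℝ) := ⟨1 / 2, 1, by norm_num, by norm_num⟩

/-- A bump function as a test function. -/
def bump : TestFn where
  toFun x := (realBump x : ℂ)
  contDiff' := Complex.ofRealCLM.contDiff.comp realBump.contDiff
  hasCompactSupport' := realBump.hasCompactSupport.comp_left Complex.ofReal_zero
  tsupport_subset' := subset_univ _

theorem ft_bump_zero : bump.ft 0 ≠ 0 := by
  have h : bump.ft 0 = ((∫ x, realBump x : ℝ) : ℂ) := by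
    rw [ft, ← integral_complex_ofReal]
    refine integral_congr_ae (Eventually.of_forall fun x => ?_)
    change Complex.exp (Complex.I * x * (0 : ℝ)) * (realBump x : ℂ) = _
    simp
  rw [h]
  exact_mod_cast (realBump.integral_pos (μ := volume)).ne'

theorem exists_norm_toL2_eq_one : ∃ k : TestFn, ‖k.toL2‖ = 1 := by
  -- Otherwise Plancherel would make the continuous function `bump.hat` vanish identically,
  -- contradicting `ft_bump_zero`.
  have hne : ‖bump.toL2‖ ≠ 0 := by
    intro h
    have h1 := lintegral_hatL2 bump.toL2
    rw [← enorm_norm bump.toL2, h, lintegral_congr_ae (bump.hatL2_toL2.mono fun s hs => by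
      simp only [hs] : (fun s => ‖hatL2 bump.toL2 s‖ₑ ^ 2) =ᵐ[volume] fun s => ‖bump.hat s‖ₑ ^ 2)] at h1
    simp only [enorm_zero, ne_eq, OfNat.ofNat_ne_zero, not_false_eq_true, zero_pow] at h1
    have hc : Continuous fun s => ‖bump.hat s‖ₑ ^ 2 := by
      have := bump.continuous_hat
      fun_prop
    rw [lintegral_eq_zero_iff hc.measurable] at h1
    have h2 := (Continuous.ae_eq_iff_eq volume hc continuous_zero).1 h1
    have h3 := congrFun h2 0
    simp only [Pi.zero_apply, pow_eq_zero_iff two_ne_zero, enorm_eq_zero, hat, mul_eq_zero,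
      ft_bump_zero, or_false, inv_eq_zero, Complex.ofReal_eq_zero] at h3
    exact (Real.sqrt_pos.2 Real.two_pi_pos).ne' h3
  refine ⟨((‖bump.toL2‖ : ℂ)⁻¹) • bump, ?_⟩
  have h : (((‖bump.toL2‖ : ℂ)⁻¹) • bump).toL2 = ((‖bump.toL2‖ : ℂ)⁻¹) • bump.toL2 := by
    refine Lp.ext ?_
    filter_upwards [(((‖bump.toL2‖ : ℂ)⁻¹) • bump).coeFn_toL2, bump.coeFn_toL2,
      Lp.coeFn_smul ((‖bump.toL2‖ : ℂ)⁻¹) bump.toL2] with x h1 h2 h3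
    rw [h1, h3, Pi.smul_apply, h2]
    rfl
  rw [h, norm_smul]
  simp [hne]

theorem mul_comm' (f g : TestFn) : f.mul g = g.mul f :=
  TestFunction.ext fun x => _root_.mul_comm (f x) (g x)

theorem modulate_mul (f g : TestFn) (t : ℝ) : (f.modulate t).mul g = (f.mul g).modulate t :=
  TestFunction.ext fun x => mul_assoc _ (f x) (g x)

theorem iteratedDeriv_dilate (κ : TestFn) (c : ℝ) (hc : c ≠ 0) (j : ℕ) (x : ℝ) :
    iteratedDeriv j (κ.dilate c hc) x = (c : ℂ) ^ j * iteratedDeriv j κ (c * x) := by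
  have h := congrFun (iteratedDeriv_comp_const_smul (n := j)
    (κ.contDiff.of_le (by exact_mod_cast le_top)) c) x
  refine Eq.trans h ?_
  rw [Complex.real_smul, Complex.ofReal_pow]

/-- The form of the dilated and modulated function is the distribution applied to a dilated and
modulated autocorrelation. -/
theorem exists_corr_eq (k : TestFn) (c : ℝ) (hc : 0 < c) (s : ℝ) :
    ∃ f : TestFn, f.corr f.conjugate = ((k.corr k.conjugate).dilate c hc.ne').modulate s := by
  -- The factor `√c` compensates the dilation in the `L²` norm; the phases at `x + y` and `y`
  -- combine to a phase in `x` alone.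
  refine ⟨((Real.sqrt c : ℝ) : ℂ) • (k.dilate c hc.ne').modulate s, TestFunction.ext fun x => ?_⟩
  have hsq : ((Real.sqrt c : ℝ) : ℂ) * ((Real.sqrt c : ℝ) : ℂ) = c := by
    rw [← Complex.ofReal_mul, Real.mul_self_sqrt hc.le]
  have h1 (y : ℝ) : (((Real.sqrt c : ℝ) : ℂ) • (k.dilate c hc.ne').modulate s) (x + y) *
      conj ((((Real.sqrt c : ℝ) : ℂ) • (k.dilate c hc.ne').modulate s) y) =
      (c * Complex.exp (-(Complex.I * x * s))) * (k (c * x + c * y) * conj (k (c * y))) := by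
    change ((Real.sqrt c : ℝ) : ℂ) * (Complex.exp (-(Complex.I * ↑(x + y) * s)) * k (c * (x + y))) *
      conj (((Real.sqrt c : ℝ) : ℂ) * (Complex.exp (-(Complex.I * y * s)) * k (c * y))) = _
    rw [mul_add c x y, map_mul (starRingEnd ℂ), map_mul (starRingEnd ℂ), Complex.conj_ofReal,
      ← Complex.exp_conj, ← hsq]
    have h2 : Complex.exp (-(Complex.I * ↑(x + y) * s)) *
        Complex.exp (conj (-(Complex.I * y * s))) = Complex.exp (-(Complex.I * x * s)) := by
      rw [← Complex.exp_add]
      congr 1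
      simp
      ring
    rw [← h2]
    ring
  rw [corr_apply]
  simp_rw [conjugate_apply, h1]
  rw [integral_const_mul, modulate_apply, dilate_apply, corr_apply,
    Measure.integral_comp_mul_left (fun y => k (c * x + y) * conj (k y)) c,
    abs_of_pos (inv_pos.2 hc), Complex.real_smul]
  have : (c : ℂ) ≠ 0 := by exact_mod_cast hc.ne'
  push_cast
  field_simp
  rfl

end TestFn

namespace AntiDistribution

/-- The argument is an autocorrelation, and its value at the origin, here `‖k‖² = 1`, is the squared
norm of the underlying test function. The lower bound on the form thus reads `γ`. -/
theorem apply_dilate_modulate {w : AntiDistribution} (hw : w.IsHermitian) {γ : ℝ}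
    (hγ : ∀ f : TestFn, γ * ‖f.toL2‖ ^ 2 ≤ w.form f) {k : TestFn} (hk : ‖k.toL2‖ = 1)
    (c : ℝ) (hc : 0 < c) (s : ℝ) :
    (w (((k.corr k.conjugate).dilate c hc.ne').modulate s)).im = 0 ∧
      γ ≤ (w (((k.corr k.conjugate).dilate c hc.ne').modulate s)).re := by
  obtain ⟨f, hf⟩ := k.exists_corr_eq c hc s
  rw [← hf]
  refine ⟨im_eq_zero hw f, ?_⟩
  have h1 := f.corr_conjugate_zero
  rw [hf] at h1
  simp only [TestFn.modulate_apply, TestFn.dilate_apply, mul_zero, Complex.ofReal_zero, zero_mul,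
    neg_zero, Complex.exp_zero, one_mul, k.corr_conjugate_zero, hk] at h1
  have h2 := hγ f
  rw [← (Complex.ofReal_injective h1)] at h2
  simpa [form] using h2

theorem inv_succ_pos (n : ℕ) : (0 : ℝ) < ((n : ℝ) + 1)⁻¹ := by positivity

/-- In the Leibniz expansion each derivative of the cutoff brings a factor `c = 1 / (n + 1)`, so
only the undifferentiated term survives, with limit factor `κ 0 = 1` by dominated convergence. -/
theorem tendsto_apply_mul_dilate (w : AntiDistribution) (η κ : TestFn) (hκ : κ 0 = 1) :
    Tendsto (fun n : ℕ => w (η.mul (κ.dilate _ (inv_succ_pos n).ne'))) atTop (𝓝 (w η)) := by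
  obtain ⟨R, hR, hη⟩ := η.exists_support_subset
  obtain ⟨m, g, hg, h⟩ := w.exists_eq_integral_iteratedDeriv R hR
  have hc : Tendsto (fun n : ℕ => ((n : ℝ) + 1)⁻¹) atTop (𝓝 0) := by
    simpa using tendsto_one_div_add_atTop_nhds_zero_nat (𝕜 := ℝ)
  have e (n : ℕ) : w (η.mul (κ.dilate _ (inv_succ_pos n).ne')) =
      ∑ j ∈ Finset.range (m + 1), (m.choose j : ℂ) * ∫ x,
        conj (((((n : ℝ) + 1)⁻¹ : ℝ) : ℂ) ^ j * iteratedDeriv j κ (((n : ℝ) + 1)⁻¹ * x)) *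
          η.weight g (m - j) x := by
    rw [η.mul_comm', h _ (fun x hx => by simp [hη x hx]), TestFn.mul,
      integral_conj_iteratedDeriv_mulSmooth hg]
    simp_rw [TestFn.iteratedDeriv_dilate]
  simp_rw [e]
  have lim : ∑ j ∈ Finset.range (m + 1), (m.choose j : ℂ) * ∫ x,
        conj (((0 : ℝ) : ℂ) ^ j * iteratedDeriv j κ (0 * x)) * η.weight g (m - j) x = w η := by
    rw [Finset.sum_eq_single 0 (fun j _ hj => by simp [hj]) (by simp), h η hη]
    simp [TestFn.weight, hκ]
  rw [← lim]
  refine tendsto_finsetSum _ fun j _ => Tendsto.const_mul _ ?_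
  obtain ⟨C, hC0, hC⟩ := κ.exists_norm_iteratedDeriv_le j
  have hcont := κ.continuous_iteratedDeriv' j
  refine tendsto_integral_of_dominated_convergence (fun x => C * ‖η.weight g (m - j) x‖)
    (fun n => ?_) ((η.integrable_weight hg _).norm.const_mul C) (fun n => ?_) ?_
  · exact (Continuous.aestronglyMeasurable (by fun_prop)).mul (η.integrable_weight hg _).1
  · refine Eventually.of_forall fun x => ?_
    rw [norm_mul]
    refine mul_le_mul_of_nonneg_right ?_ (norm_nonneg _)
    rw [RCLike.norm_conj, norm_mul, norm_pow, Complex.norm_real, Real.norm_of_nonneg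
      (inv_succ_pos n).le]
    have h1 : ((n : ℝ) + 1)⁻¹ ^ j ≤ 1 := pow_le_one₀ (inv_succ_pos n).le
      (inv_le_one_of_one_le₀ (by simp))
    calc _ ≤ 1 * C := mul_le_mul h1 (hC _) (norm_nonneg _) zero_le_one
      _ = C := one_mul C
  · refine Eventually.of_forall fun x => Tendsto.mul_const _ ?_
    have hF : Continuous fun c : ℝ => conj ((c : ℂ) ^ j * iteratedDeriv j κ (c * x)) := by fun_prop
    exact (hF.tendsto 0).comp hc

/-- Dilating by a factor at most one does not increase the sup norms of derivatives. -/
theorem exists_norm_iteratedDeriv_mul_dilate_le (θ κ : TestFn) (i : ℕ) :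
    ∃ B : ℝ, 0 ≤ B ∧ ∀ (n : ℕ) (x : ℝ),
      ‖iteratedDeriv i (θ.mul (κ.dilate _ (inv_succ_pos n).ne')) x‖ ≤ B := by
  choose C hC0 hC using fun j => θ.exists_norm_iteratedDeriv_le j
  choose C' hC0' hC' using fun j => κ.exists_norm_iteratedDeriv_le j
  refine ⟨∑ j ∈ Finset.range (i + 1), i.choose j * C j * C' (i - j),
    Finset.sum_nonneg fun j _ => mul_nonneg (mul_nonneg (by positivity) (hC0 j)) (hC0' _),
    fun n x => ?_⟩
  have h : iteratedDeriv i (θ.mul (κ.dilate _ (inv_succ_pos n).ne')) x =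
      ∑ j ∈ Finset.range (i + 1), i.choose j * iteratedDeriv j θ x *
        iteratedDeriv (i - j) (κ.dilate _ (inv_succ_pos n).ne') x :=
    iteratedDeriv_fun_mul (f := θ) (g := κ.dilate _ (inv_succ_pos n).ne')
      (θ.contDiff.of_le (by exact_mod_cast le_top)).contDiffAt
      ((κ.dilate _ (inv_succ_pos n).ne').contDiff.of_le (by exact_mod_cast le_top)).contDiffAt
  rw [h]
  refine (norm_sum_le _ _).trans (Finset.sum_le_sum fun j _ => ?_)
  rw [norm_mul, norm_mul, TestFn.iteratedDeriv_dilate, norm_mul, norm_pow, Complex.norm_real,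
    Real.norm_of_nonneg (inv_succ_pos n).le, Complex.norm_natCast]
  have h1 : ((n : ℝ) + 1)⁻¹ ^ (i - j) ≤ 1 := pow_le_one₀ (inv_succ_pos n).le
    (inv_le_one_of_one_le₀ (by simp))
  refine mul_le_mul (mul_le_mul_of_nonneg_left (hC j x) (by positivity)) ?_ (by positivity)
    (mul_nonneg (by positivity) (hC0 j))
  calc _ ≤ 1 * C' (i - j) := mul_le_mul h1 (hC' _ _) (norm_nonneg _) zero_le_one
    _ = _ := one_mul _

/-- Growth in `t` comes only from derivatives falling on the exponential, at most `m` of them.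
Uniformity in `n` is what later gives compactness. -/
theorem exists_norm_apply_modulate_mul_le (w : AntiDistribution) (θ κ : TestFn) :
    ∃ (m : ℕ) (C : ℝ), 0 ≤ C ∧ ∀ (n : ℕ) (t : ℝ),
      ‖w ((θ.modulate t).mul (κ.dilate _ (inv_succ_pos n).ne'))‖ ≤ C * (1 + t ^ 2) ^ m := by
  obtain ⟨R, hR, hθ⟩ := θ.exists_support_subset
  obtain ⟨m, g, hg, h⟩ := w.exists_eq_integral_iteratedDeriv R hR
  choose B hB0 hB using fun i => exists_norm_iteratedDeriv_mul_dilate_le θ κ i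
  have hg0 : 0 ≤ ∫ x, ‖g x‖ := integral_nonneg fun _ => norm_nonneg _
  refine ⟨m, ∑ j ∈ Finset.range (m + 1), m.choose j * (B (m - j) * ∫ x, ‖g x‖),
    Finset.sum_nonneg fun j _ => mul_nonneg (by positivity) (mul_nonneg (hB0 _) hg0),
    fun n t => ?_⟩
  rw [TestFn.modulate_mul, h _ (fun x hx => by simp [hθ x hx]),
    integral_conj_iteratedDeriv_modulate hg, Finset.sum_mul]
  refine (norm_sum_le _ _).trans (Finset.sum_le_sum fun j hj => ?_)
  rw [norm_mul, norm_mul, Complex.norm_natCast, norm_pow, norm_mul, Complex.norm_I, one_mul,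
    Complex.norm_real, Real.norm_eq_abs, mul_assoc, mul_assoc, mul_comm (B (m - j) * _)]
  refine mul_le_mul_of_nonneg_left ?_ (by positivity)
  refine mul_le_mul ?_ ((norm_integral_exp_mul_le t).trans ?_) (norm_nonneg _) (by positivity)
  · calc |t| ^ j ≤ (1 + t ^ 2) ^ j := by
          gcongr
          nlinarith [sq_abs t, abs_nonneg t, sq_nonneg (|t| - 1)]
      _ ≤ (1 + t ^ 2) ^ m := pow_le_pow_right₀ (by nlinarith [sq_nonneg t])
          (Nat.lt_succ_iff.1 (Finset.mem_range.1 hj))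
  · rw [← integral_const_mul]
    refine integral_mono (TestFn.integrable_weight _ hg _).norm (hg.norm.const_mul _) fun x => ?_
    rw [TestFn.weight, norm_mul, RCLike.norm_conj]
    exact mul_le_mul_of_nonneg_right (hB _ n x) (norm_nonneg _)

end AntiDistribution

/-! ### Uniform polynomial growth and compactness -/

/-- The weight `(1 + s²)^(-q)`. -/
def japWeight (q : ℕ) (s : ℝ) : ℝ≥0∞ := ENNReal.ofReal ((1 + s ^ 2) ^ q)⁻¹

@[fun_prop]
theorem continuous_japWeight (q : ℕ) : Continuous (japWeight q) := by
  refine ENNReal.continuous_ofReal.comp (Continuous.inv₀ (by fun_prop) fun s => ?_)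
  positivity

theorem measurable_japWeight (q : ℕ) : Measurable (japWeight q) :=
  (continuous_japWeight q).measurable

theorem japWeight_ne_top (q : ℕ) (s : ℝ) : japWeight q s ≠ ∞ := ENNReal.ofReal_ne_top

theorem japWeight_toReal (q : ℕ) (s : ℝ) : (japWeight q s).toReal = ((1 + s ^ 2) ^ q)⁻¹ :=
  ENNReal.toReal_ofReal (by positivity)

theorem japWeight_anti {q r : ℕ} (h : q ≤ r) (s : ℝ) : japWeight r s ≤ japWeight q s := by
  refine ENNReal.ofReal_le_ofReal (inv_anti₀ (by positivity) ?_)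
  exact pow_le_pow_right₀ (by nlinarith [sq_nonneg s]) h

theorem japWeight_mul_ofReal (q : ℕ) (s : ℝ) :
    japWeight q s * ENNReal.ofReal ((1 + s ^ 2) ^ q) = 1 := by
  rw [japWeight, ← ENNReal.ofReal_mul (by positivity), inv_mul_cancel₀ (by positivity),
    ENNReal.ofReal_one]

theorem lintegral_japWeight_one_lt_top : ∫⁻ s, japWeight 1 s < ∞ := by
  have h : Integrable fun s : ℝ => (1 + s ^ 2)⁻¹ := integrable_inv_one_add_sq
  have := h.lintegral_lt_top
  simpa [japWeight] using this

/-- A measure with uniformly polynomially bounded mass on intervals of a fixed length has polynomial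
growth. -/
theorem lintegral_japWeight_le (μ : Measure ℝ) [SFinite μ] {δ : ℝ} (hδ : 0 < δ) (hδ1 : δ ≤ 1)
    (m : ℕ) (C : ℝ≥0∞)
    (h : ∀ t, μ (Icc (t - δ) (t + δ)) ≤ C * ENNReal.ofReal ((1 + t ^ 2) ^ m)) :
    ENNReal.ofReal (2 * δ * (3 ^ (m + 1))⁻¹) * ∫⁻ s, japWeight (m + 1) s ∂μ ≤
      C * ∫⁻ t, japWeight 1 t := by
  -- Tonelli for the weight `(1 + t²)^(-(m+1))` on the strip `|s - t| ≤ δ`: integrating in `t` first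
  -- recovers the weight at `s`, integrating in `s` first uses the mass bound and leaves `(1 +
  -- t²)^(-1)`.
  let J : ℝ → ℝ → ℝ≥0∞ := fun t s => (Icc (t - δ) (t + δ)).indicator (fun _ => japWeight (m + 1) t) s
  have hset : MeasurableSet {p : ℝ × ℝ | p.2 ∈ Icc (p.1 - δ) (p.1 + δ)} := by
    have h1 : IsClosed {p : ℝ × ℝ | p.1 - δ ≤ p.2} := isClosed_le (by fun_prop) (by fun_prop)
    have h2 : IsClosed {p : ℝ × ℝ | p.2 ≤ p.1 + δ} := isClosed_le (by fun_prop) (by fun_prop)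
    exact (h1.inter h2).measurableSet
  have hJ : Measurable (Function.uncurry J) := by
    have : Function.uncurry J = {p : ℝ × ℝ | p.2 ∈ Icc (p.1 - δ) (p.1 + δ)}.indicator
        fun p => japWeight (m + 1) p.1 := by
      ext p; simp [J, Function.uncurry, indicator]
    rw [this]
    exact ((measurable_japWeight _).comp measurable_fst).indicator hset
  calc ENNReal.ofReal (2 * δ * (3 ^ (m + 1))⁻¹) * ∫⁻ s, japWeight (m + 1) s ∂μ
      = ∫⁻ s, ENNReal.ofReal (2 * δ * (3 ^ (m + 1))⁻¹) * japWeight (m + 1) s ∂μ :=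
        (lintegral_const_mul _ (measurable_japWeight _)).symm
    _ ≤ ∫⁻ s, ∫⁻ t, J t s ∂volume ∂μ := by
        refine lintegral_mono fun s => ?_
        have h1 : ∫⁻ t in Icc (s - δ) (s + δ),
            ENNReal.ofReal ((3 ^ (m + 1))⁻¹ * ((1 + s ^ 2) ^ (m + 1))⁻¹) ≤ ∫⁻ t, J t s := by
          rw [← lintegral_indicator measurableSet_Icc]
          refine lintegral_mono fun t => ?_
          by_cases ht : t ∈ Icc (s - δ) (s + δ)
          · have hs : s ∈ Icc (t - δ) (t + δ) := ⟨by linarith [ht.2], by linarith [ht.1]⟩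
            simp only [J, indicator_of_mem ht, indicator_of_mem hs]
            refine ENNReal.ofReal_le_ofReal ?_
            rw [← mul_inv, ← mul_pow]
            refine inv_anti₀ (by positivity) (pow_le_pow_left₀ (by positivity) ?_ _)
            have h3 : (t - s) ^ 2 ≤ 1 := by
              have h4 := ht.1; have h5 := ht.2
              rw [sq_le_one_iff_abs_le_one, abs_le]
              constructor <;> linarith
            -- From `|t - s| ≤ 1` one gets `t² ≤ 2s² + 2`, hence `1 + t² ≤ 3(1 + s²)`; this is the
            -- origin of the constant 3.
            nlinarith [sq_nonneg (t - 2 * s)]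
          · simp [indicator_of_notMem ht]
        refine le_trans (le_of_eq ?_) h1
        rw [setLIntegral_const, Real.volume_Icc, japWeight, ← ENNReal.ofReal_mul (by positivity),
          ← ENNReal.ofReal_mul (by positivity)]
        congr 1
        ring
    _ = ∫⁻ t, ∫⁻ s, J t s ∂μ ∂volume := (lintegral_lintegral_swap hJ.aemeasurable).symm
    _ ≤ ∫⁻ t, C * japWeight 1 t := by
        refine lintegral_mono fun t => ?_
        dsimp only [J]
        rw [lintegral_indicator_const measurableSet_Icc]
        calc japWeight (m + 1) t * μ (Icc (t - δ) (t + δ))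
            ≤ japWeight (m + 1) t * (C * ENNReal.ofReal ((1 + t ^ 2) ^ m)) := by gcongr; exact h t
          _ = C * (japWeight (m + 1) t * ENNReal.ofReal ((1 + t ^ 2) ^ m)) := by ring
          _ = C * japWeight 1 t := by
            rw [japWeight, ← ENNReal.ofReal_mul (by positivity), japWeight]
            congr 2
            have : (1 + t ^ 2) ≠ 0 := by positivity
            field_simp
            ring
    _ = C * ∫⁻ t, japWeight 1 t := lintegral_const_mul _ (measurable_japWeight _)

/-- Sequences of measures of uniform polynomial growth have limit points. -/
theorem exists_limit_of_lintegral_japWeight_le (μ : ℕ → Measure ℝ) (q : ℕ) {K : ℝ≥0∞}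
    (hK : K ≠ ∞) (h : ∀ n, ∫⁻ s, japWeight q s ∂μ n ≤ K) :
    ∃ ν : Measure ℝ, ∫⁻ s, japWeight (q + 1) s ∂ν < ∞ ∧ ∃ F : Ultrafilter ℕ, ↑F ≤ atTop (α := ℕ) ∧
      ∀ g : ℝ → ℂ, Continuous g → (∃ C : ℝ, ∀ s, (1 + s ^ 2) ^ (q + 1) * ‖g s‖ ≤ C) →
        Tendsto (fun n => ∫ s, g s ∂μ n) F (𝓝 (∫ s, g s ∂ν)) := by
  -- The weighted measures are finite, and the extra power of the weight gains `(1 + j²)^(-1)`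
  -- outside `[-j, j]`, hence tightness.
  let κ : ℕ → Measure ℝ := fun n => (μ n).withDensity (japWeight (q + 1))
  have hκle (n : ℕ) : κ n univ ≤ K := by
    rw [withDensity_apply _ MeasurableSet.univ, setLIntegral_univ]
    exact (lintegral_mono fun s => japWeight_anti (Nat.le_succ q) s).trans (h n)
  have hfin (n : ℕ) : IsFiniteMeasure (κ n) := ⟨(hκle n).trans_lt hK.lt_top⟩
  let κ' : ℕ → FiniteMeasure ℝ := fun n => ⟨κ n, hfin n⟩
  let u : ℕ → NNReal := fun j => K.toNNReal * Real.toNNReal (1 + (j : ℝ) ^ 2)⁻¹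
  have hu : Tendsto u atTop (𝓝 0) := by
    have h1 : Tendsto (fun j : ℕ => (1 + (j : ℝ) ^ 2)⁻¹) atTop (𝓝 0) :=
      tendsto_inv_atTop_zero.comp (tendsto_atTop_add_const_left _ _
        ((tendsto_pow_atTop two_ne_zero).comp tendsto_natCast_atTop_atTop))
    have h2 := (continuous_real_toNNReal.tendsto 0).comp h1
    simpa using h2.const_mul K.toNNReal
  have hcomp := isCompact_setOfPred_finiteMeasure_mass_le_compl_isCompact_le (E := ℝ) K.toNNReal hu
    (K := fun j : ℕ => Icc (-(j : ℝ)) j) (fun j => isCompact_Icc) (Or.inl inferInstance)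
  have hmem (n : ℕ) : κ' n ∈ {μ : FiniteMeasure ℝ | μ.mass ≤ K.toNNReal ∧
      ∀ j : ℕ, μ (Icc (-(j : ℝ)) j)ᶜ ≤ u j} := by
    refine ⟨ENNReal.toNNReal_mono hK (hκle n), fun j => ?_⟩
    have h1 : κ n (Icc (-(j : ℝ)) j)ᶜ ≤ (u j : ℝ≥0∞) := by
      rw [withDensity_apply _ measurableSet_Icc.compl, ENNReal.coe_mul, ENNReal.coe_toNNReal hK]
      calc ∫⁻ s in (Icc (-(j : ℝ)) j)ᶜ, japWeight (q + 1) s ∂μ n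
          ≤ ∫⁻ s in (Icc (-(j : ℝ)) j)ᶜ, ENNReal.ofReal (1 + (j : ℝ) ^ 2)⁻¹ * japWeight q s ∂μ n := by
            refine setLIntegral_mono' measurableSet_Icc.compl fun s hs => ?_
            rw [japWeight, japWeight, ← ENNReal.ofReal_mul (by positivity)]
            refine ENNReal.ofReal_le_ofReal ?_
            rw [pow_succ', mul_inv]
            refine mul_le_mul_of_nonneg_right (inv_anti₀ (by positivity) ?_) (by positivity)
            have hj : (j : ℝ) ≤ |s| := by
              by_contra hlt
              exact hs (abs_le.1 (not_le.1 hlt).le)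
            have := sq_abs s
            nlinarith [(Nat.cast_nonneg j : (0 : ℝ) ≤ j)]
        _ = ENNReal.ofReal (1 + (j : ℝ) ^ 2)⁻¹ * ∫⁻ s in (Icc (-(j : ℝ)) j)ᶜ, japWeight q s ∂μ n :=
            lintegral_const_mul _ (measurable_japWeight q)
        _ ≤ ENNReal.ofReal (1 + (j : ℝ) ^ 2)⁻¹ * K := by
            gcongr
            exact (setLIntegral_le_lintegral _ _).trans (h n)
        _ = K * _ := mul_comm _ _
    exact ENNReal.toNNReal_mono ENNReal.coe_ne_top h1
  let F : Ultrafilter ℕ := Filter.hyperfilter ℕ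
  have hF : (F : Filter ℕ) ≤ atTop := Nat.hyperfilter_le_atTop
  obtain ⟨ν, -, hν⟩ := hcomp.ultrafilter_le_nhds (F.map κ')
    (le_principal_iff.2 (Filter.mem_map.2 (Filter.univ_mem' hmem)))
  -- Undo the weight on the weak limit. Test functions `g` with enough decay become bounded
  -- continuous once multiplied by the inverse weight.
  refine ⟨(ν : Measure ℝ).withDensity fun s => ENNReal.ofReal ((1 + s ^ 2) ^ (q + 1)), ?_, F, hF, ?_⟩
  · rw [lintegral_withDensity_eq_lintegral_mul _ (by fun_prop) (measurable_japWeight _)]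
    have : ((fun s : ℝ => ENNReal.ofReal ((1 + s ^ 2) ^ (q + 1))) * japWeight (q + 1)) =
        fun _ => 1 := by
      ext s
      rw [Pi.mul_apply, mul_comm, japWeight_mul_ofReal]
    rw [this, lintegral_one]
    exact measure_lt_top _ _
  · rintro g hg ⟨C, hC⟩
    let G : ℝ →ᵇ ℂ := BoundedContinuousFunction.ofNormedAddCommGroup
      (fun s => (((1 + s ^ 2) ^ (q + 1) : ℝ) : ℂ) * g s) (by fun_prop) C (fun s => by
        rw [norm_mul, Complex.norm_real, Real.norm_of_nonneg (by positivity)]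
        exact hC s)
    have hlim := (FiniteMeasure.tendsto_iff_forall_integral_rclike_tendsto ℂ
      (F := (F : Filter ℕ)) (μs := κ') (μ := ν)).1 hν G
    have e1 (n : ℕ) : ∫ s, G s ∂(κ' n : Measure ℝ) = ∫ s, g s ∂μ n := by
      change ∫ s, G s ∂((μ n).withDensity (japWeight (q + 1))) = _
      rw [integral_withDensity_eq_integral_toReal_smul (measurable_japWeight _)
        (Eventually.of_forall fun s => (japWeight_ne_top _ s).lt_top)]
      refine integral_congr_ae (Eventually.of_forall fun s => ?_)
      have h0 : (((1 + s ^ 2) ^ (q + 1) : ℝ) : ℂ) ≠ 0 := by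
        exact_mod_cast (by positivity : ((1 + s ^ 2) ^ (q + 1) : ℝ) ≠ 0)
      change (japWeight (q + 1) s).toReal • ((((1 + s ^ 2) ^ (q + 1) : ℝ) : ℂ) * g s) = g s
      rw [japWeight_toReal, Complex.real_smul, Complex.ofReal_inv, inv_mul_cancel_left₀ h0]
    have e2 : ∫ s, g s ∂((ν : Measure ℝ).withDensity fun s =>
        ENNReal.ofReal ((1 + s ^ 2) ^ (q + 1))) = ∫ s, G s ∂(ν : Measure ℝ) := by
      rw [integral_withDensity_eq_integral_toReal_smul (by fun_prop)
        (Eventually.of_forall fun s => ENNReal.ofReal_lt_top)]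
      refine integral_congr_ae (Eventually.of_forall fun s => ?_)
      change _ = (((1 + s ^ 2) ^ (q + 1) : ℝ) : ℂ) * g s
      dsimp only
      rw [ENNReal.toReal_ofReal (by positivity), Complex.real_smul]
    rw [e2]
    simpa only [e1] using hlim

/-! ### The Bochner-Schwartz theorem -/

namespace AntiDistribution

/-- The density approximating the spectral measure. -/
def approxDensity (w : AntiDistribution) (γ : ℝ) (κ : TestFn) (n : ℕ) (s : ℝ) : ℝ≥0∞ :=
  ENNReal.ofReal ((w ((κ.dilate _ (inv_succ_pos n).ne').modulate s)).re - γ)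

theorem measurable_approxDensity (w : AntiDistribution) (γ : ℝ) (κ : TestFn) (n : ℕ) :
    Measurable (w.approxDensity γ κ n) := by
  have h := w.continuous_apply_modulate (κ.dilate _ (inv_succ_pos n).ne')
  exact (ENNReal.continuous_ofReal.comp
    ((Complex.continuous_re.comp h).sub continuous_const)).measurable

end AntiDistribution

namespace TestFn

theorem integral_conj_ft (η : TestFn) :
    ∫ s, conj (η.ft s) = (2 * Real.pi : ℂ) * conj (η 0) := by
  have h := η.eq_integral_ft 0
  simp only [Complex.ofReal_zero, mul_zero, zero_mul, neg_zero, Complex.exp_zero, mul_one] at h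
  have hpi : (Real.pi : ℂ) ≠ 0 := by exact_mod_cast Real.pi_ne_zero
  rw [h, integral_conj, map_mul, map_inv₀, map_mul, Complex.conj_ofReal, Complex.conj_ofNat]
  field_simp

theorem integrable_conj_ft (η : TestFn) : Integrable fun s => conj (η.ft s) := by
  refine η.integrable_ft.mono (by have := η.continuous_ft; fun_prop) ?_
  exact Eventually.of_forall fun s => by simp

end TestFn

namespace AntiDistribution

/-- The truncation in `ENNReal.ofReal` is inactive, because the value of `w` is real and at least
`γ`. -/
theorem approxDensity_toReal {w : AntiDistribution} (hw : w.IsHermitian) {γ : ℝ}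
    (hγ : ∀ f : TestFn, γ * ‖f.toL2‖ ^ 2 ≤ w.form f) {k : TestFn} (hk : ‖k.toL2‖ = 1)
    (n : ℕ) (s : ℝ) :
    ((w.approxDensity γ (k.corr k.conjugate) n s).toReal : ℂ) =
      w (((k.corr k.conjugate).dilate _ (inv_succ_pos n).ne').modulate s) - γ := by
  obtain ⟨h1, h2⟩ := apply_dilate_modulate hw hγ hk _ (inv_succ_pos n) s
  rw [approxDensity, ENNReal.toReal_ofReal (by linarith)]
  apply Complex.ext
  · simp
  · simp [h1]

theorem integral_conj_ft_approxDensity {w : AntiDistribution} (hw : w.IsHermitian) {γ : ℝ}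
    (hγ : ∀ f : TestFn, γ * ‖f.toL2‖ ^ 2 ≤ w.form f) {k : TestFn} (hk : ‖k.toL2‖ = 1)
    (n : ℕ) (η : TestFn) :
    Integrable (fun s => conj (η.ft s))
      (volume.withDensity (w.approxDensity γ (k.corr k.conjugate) n)) ∧
    ∫ s, conj (η.ft s) ∂(volume.withDensity (w.approxDensity γ (k.corr k.conjugate) n)) =
      (2 * Real.pi : ℂ) * (w (η.mul ((k.corr k.conjugate).dilate _ (inv_succ_pos n).ne')) -
        γ * conj (η 0)) := by
  set κ := k.corr k.conjugate
  have hfin : ∀ᵐ s : ℝ, w.approxDensity γ κ n s < ∞ :=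
    Eventually.of_forall fun s => ENNReal.ofReal_lt_top
  obtain ⟨h1, h2⟩ := w.apply_mul_eq_integral (κ.dilate _ (inv_succ_pos n).ne') η
  have e (s : ℝ) : (w.approxDensity γ κ n s).toReal • conj (η.ft s) =
      conj (η.ft s) * w ((κ.dilate _ (inv_succ_pos n).ne').modulate s) -
        γ * conj (η.ft s) := by
    rw [Complex.real_smul, approxDensity_toReal hw hγ hk]
    ring
  have hpi : (Real.pi : ℂ) ≠ 0 := by exact_mod_cast Real.pi_ne_zero
  constructor
  · rw [integrable_withDensity_iff_integrable_smul' (w.measurable_approxDensity γ κ n) hfin]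
    simp_rw [e]
    exact h1.sub (η.integrable_conj_ft.const_mul _)
  · rw [integral_withDensity_eq_integral_toReal_smul (w.measurable_approxDensity γ κ n) hfin]
    simp_rw [e]
    rw [integral_sub h1 (η.integrable_conj_ft.const_mul _), integral_const_mul,
      TestFn.integral_conj_ft, h2]
    field_simp

/-- Pair the densities with the modulation by `t` of the autocorrelation of a bump `b`: its
transform `|b̂(s - t)|²` is nonnegative and bounded below near `t`, so the polynomial bound on `w`
bounds the mass near `t`. -/
theorem exists_approxDensity_growth {w : AntiDistribution} (hw : w.IsHermitian) {γ : ℝ}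
    (hγ : ∀ f : TestFn, γ * ‖f.toL2‖ ^ 2 ≤ w.form f) {k : TestFn} (hk : ‖k.toL2‖ = 1) :
    ∃ (q : ℕ) (K : ℝ≥0∞), K ≠ ∞ ∧ ∀ n,
      ∫⁻ s, japWeight q s ∂(volume.withDensity (w.approxDensity γ (k.corr k.conjugate) n)) ≤ K := by
  set κ := k.corr k.conjugate
  let b := TestFn.bump
  let θ := b.corr b.conjugate
  obtain ⟨m, C, hC0, hC⟩ := w.exists_norm_apply_modulate_mul_le θ κ
  have hcont : Continuous fun s => ‖b.ft s‖ ^ 2 := b.continuous_ft.norm.pow 2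
  have hpos : 0 < ‖b.ft 0‖ ^ 2 := by
    have := norm_pos_iff.2 TestFn.ft_bump_zero
    positivity
  set a := ‖b.ft 0‖ ^ 2 / 2 with ha
  have ha0 : 0 < a := by positivity
  obtain ⟨ε, hε, hεa⟩ := Metric.eventually_nhds_iff.1
    (hcont.continuousAt.eventually_const_lt (half_lt_self hpos : a < _))
  -- Half of `ε` keeps the closed interval inside the open ball where the transform exceeds `a`; the
  -- bound by 1 is required by `lintegral_japWeight_le`.
  set δ := min 1 (ε / 2) with hδdef
  have hδ : 0 < δ := lt_min one_pos (by linarith)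
  have hδε : δ < ε := lt_of_le_of_lt (min_le_right _ _) (by linarith)
  set C' := 2 * Real.pi * (C + |γ| * ‖θ 0‖) with hC'
  have hC'0 : 0 ≤ C' := by positivity
  have hbound (n : ℕ) (t : ℝ) :
      volume.withDensity (w.approxDensity γ κ n) (Icc (t - δ) (t + δ)) ≤
        (ENNReal.ofReal a)⁻¹ * ENNReal.ofReal C' * ENNReal.ofReal ((1 + t ^ 2) ^ m) := by
    set ν := volume.withDensity (w.approxDensity γ κ n)
    obtain ⟨h1, h2⟩ := integral_conj_ft_approxDensity hw hγ hk n (θ.modulate t)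
    have e (s : ℝ) : conj ((θ.modulate t).ft s) = ((‖b.ft (s - t)‖ ^ 2 : ℝ) : ℂ) := by
      rw [TestFn.ft_modulate, TestFn.ft_corr, Complex.conj_ofReal]
    simp_rw [e] at h1 h2
    rw [integral_complex_ofReal] at h2
    have h3 : Integrable (fun s => ‖b.ft (s - t)‖ ^ 2) ν := by
      simpa only [RCLike.re_to_complex, Complex.ofReal_re] using h1.re
    have h4 : ∫ s, ‖b.ft (s - t)‖ ^ 2 ∂ν ≤ C' * (1 + t ^ 2) ^ m := by
      refine (le_abs_self _).trans ?_
      rw [← Real.norm_eq_abs, ← Complex.norm_real, h2, norm_mul, hC', mul_assoc]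
      have : ‖(2 * Real.pi : ℂ)‖ = 2 * Real.pi := by
        rw [norm_mul, Complex.norm_real, Real.norm_of_nonneg Real.pi_pos.le]; simp
      rw [this]
      refine mul_le_mul_of_nonneg_left ((norm_sub_le _ _).trans ?_) Real.two_pi_pos.le
      rw [add_mul]
      refine add_le_add (hC n t) ?_
      have h5 : (θ.modulate t) 0 = θ 0 := by simp
      rw [h5, norm_mul, Complex.norm_real, Real.norm_eq_abs, RCLike.norm_conj]
      exact le_mul_of_one_le_right (by positivity) (one_le_pow₀ (by nlinarith [sq_nonneg t]))
    have h6 : ENNReal.ofReal a * ν (Icc (t - δ) (t + δ)) ≤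
        ENNReal.ofReal C' * ENNReal.ofReal ((1 + t ^ 2) ^ m) := by
      calc ENNReal.ofReal a * ν (Icc (t - δ) (t + δ))
          = ∫⁻ s in Icc (t - δ) (t + δ), ENNReal.ofReal a ∂ν := (setLIntegral_const _ _).symm
        _ ≤ ∫⁻ s in Icc (t - δ) (t + δ), ENNReal.ofReal (‖b.ft (s - t)‖ ^ 2) ∂ν := by
            refine setLIntegral_mono' measurableSet_Icc fun s hs => ENNReal.ofReal_le_ofReal ?_
            refine (hεa (y := s - t) ?_).le
            rw [Real.dist_eq, sub_zero]
            refine lt_of_le_of_lt (abs_le.2 ⟨?_, ?_⟩) hδε <;> linarith [hs.1, hs.2]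
        _ ≤ ∫⁻ s, ENNReal.ofReal (‖b.ft (s - t)‖ ^ 2) ∂ν := setLIntegral_le_lintegral _ _
        _ = ENNReal.ofReal (∫ s, ‖b.ft (s - t)‖ ^ 2 ∂ν) :=
            (ofReal_integral_eq_lintegral_ofReal h3
              (Eventually.of_forall fun s => by positivity)).symm
        _ ≤ _ := by
            rw [← ENNReal.ofReal_mul hC'0]
            exact ENNReal.ofReal_le_ofReal h4
    rw [mul_assoc]
    have ha' : ENNReal.ofReal a ≠ 0 := by simpa using ha0
    calc ν (Icc (t - δ) (t + δ))
        = (ENNReal.ofReal a)⁻¹ * (ENNReal.ofReal a * ν (Icc (t - δ) (t + δ))) := by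
          rw [← mul_assoc, ENNReal.inv_mul_cancel ha' ENNReal.ofReal_ne_top, one_mul]
      _ ≤ _ := by gcongr
  set c := ENNReal.ofReal (2 * δ * (3 ^ (m + 1))⁻¹)
  have hc0 : c ≠ 0 := by
    have : 0 < 2 * δ * (3 ^ (m + 1) : ℝ)⁻¹ := by positivity
    simpa [c] using this
  refine ⟨m + 1, c⁻¹ * ((ENNReal.ofReal a)⁻¹ * ENNReal.ofReal C' * ∫⁻ t, japWeight 1 t),
    ?_, fun n => ?_⟩
  · refine ENNReal.mul_ne_top (ENNReal.inv_ne_top.2 hc0) (ENNReal.mul_ne_top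
      (ENNReal.mul_ne_top (ENNReal.inv_ne_top.2 (by simpa using ha0)) ENNReal.ofReal_ne_top)
      lintegral_japWeight_one_lt_top.ne)
  · have : SFinite (volume.withDensity (w.approxDensity γ κ n)) := inferInstance
    have h := lintegral_japWeight_le (volume.withDensity (w.approxDensity γ κ n)) hδ
      (min_le_left _ _) m _ (hbound n)
    calc ∫⁻ s, japWeight (m + 1) s ∂(volume.withDensity (w.approxDensity γ κ n))
        = c⁻¹ * (c * ∫⁻ s, japWeight (m + 1) s ∂(volume.withDensity (w.approxDensity γ κ n))) := by
          rw [← mul_assoc, ENNReal.inv_mul_cancel hc0 ENNReal.ofReal_ne_top, one_mul]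
      _ ≤ _ := by gcongr

/-- The Bochner-Schwartz theorem. -/
theorem exists_measure_of_form_ge {w : AntiDistribution} (hw : w.IsHermitian) {γ : ℝ}
    (hγ : ∀ f : TestFn, γ * ‖f.toL2‖ ^ 2 ≤ w.form f) :
    ∃ (ν : Measure ℝ) (q : ℕ), ∫⁻ s, japWeight q s ∂ν < ∞ ∧ ∀ η : TestFn,
      w η = (2 * Real.pi : ℂ)⁻¹ * (∫ s, conj (η.ft s) ∂ν + γ * ∫ s, conj (η.ft s)) := by
  obtain ⟨k, hk⟩ := TestFn.exists_norm_toL2_eq_one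
  obtain ⟨q, K, hK, hbound⟩ := exists_approxDensity_growth hw hγ hk
  obtain ⟨ν, hν, F, hF, hlim⟩ := exists_limit_of_lintegral_japWeight_le _ q hK hbound
  refine ⟨ν, q + 1, hν, fun η => ?_⟩
  have hκ : (k.corr k.conjugate) 0 = 1 := by rw [k.corr_conjugate_zero, hk]; simp
  obtain ⟨C, -, hC⟩ := η.exists_ft_decay (q + 1)
  have h1 := hlim (fun s => conj (η.ft s)) (Complex.continuous_conj.comp η.continuous_ft)
    ⟨C, fun s => by rw [RCLike.norm_conj]; exact hC s⟩
  have h2 : Tendsto (fun n : ℕ => (2 * Real.pi : ℂ) *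
      (w (η.mul ((k.corr k.conjugate).dilate _ (inv_succ_pos n).ne')) - γ * conj (η 0))) F
      (𝓝 ((2 * Real.pi : ℂ) * (w η - γ * conj (η 0)))) :=
    (((w.tendsto_apply_mul_dilate η _ hκ).mono_left hF).sub_const _).const_mul _
  simp_rw [fun n => (integral_conj_ft_approxDensity hw hγ hk n η).2] at h1
  have hpi : (Real.pi : ℂ) ≠ 0 := by exact_mod_cast Real.pi_ne_zero
  -- Both limits are taken along the same ultrafilter; the term `γ ∫ conj η̂` restores the
  -- subtracted constant.
  rw [tendsto_nhds_unique h1 h2, TestFn.integral_conj_ft]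
  field_simp
  ring

end AntiDistribution

/-! ### Measures of polynomial growth -/

/-- Polynomial growth of a measure on the line. -/
def HasPolyGrowth (ν : Measure ℝ) : Prop := ∃ q : ℕ, ∫⁻ s, japWeight q s ∂ν < ∞

namespace HasPolyGrowth

variable {ν ν' : Measure ℝ}

theorem add (h : HasPolyGrowth ν) (h' : HasPolyGrowth ν') : HasPolyGrowth (ν + ν') := by
  obtain ⟨q, hq⟩ := h
  obtain ⟨q', hq'⟩ := h'
  refine ⟨max q q', ?_⟩
  rw [lintegral_add_measure]
  exact ENNReal.add_lt_top.2
    ⟨(lintegral_mono fun s => japWeight_anti (le_max_left _ _) s).trans_lt hq,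
      (lintegral_mono fun s => japWeight_anti (le_max_right _ _) s).trans_lt hq'⟩

theorem mono (h : HasPolyGrowth ν) (hle : ν' ≤ ν) : HasPolyGrowth ν' :=
  h.imp fun _ hq => (lintegral_mono' hle le_rfl).trans_lt hq

theorem volume : HasPolyGrowth (volume : Measure ℝ) := ⟨1, lintegral_japWeight_one_lt_top⟩

theorem smul (h : HasPolyGrowth ν) {c : ℝ≥0∞} (hc : c ≠ ∞) : HasPolyGrowth (c • ν) :=
  h.imp fun _ hq => by
    rw [lintegral_smul_measure]
    exact ENNReal.mul_lt_top hc.lt_top hq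

theorem measure_lt_top (h : HasPolyGrowth ν) {X : Set ℝ} (hX : Bornology.IsBounded X) :
    ν X < ∞ := by
  obtain ⟨q, hq⟩ := h
  obtain ⟨R, hR⟩ := hX.subset_closedBall 0
  have h1 : japWeight q R * ν (Metric.closedBall 0 R) ≤ ∫⁻ s, japWeight q s ∂ν := by
    rw [← setLIntegral_const]
    refine (setLIntegral_mono' Metric.isClosed_closedBall.measurableSet fun s hs => ?_).trans
      (setLIntegral_le_lintegral _ _)
    refine ENNReal.ofReal_le_ofReal (inv_anti₀ (by positivity)
      (pow_le_pow_left₀ (by positivity) ?_ _))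
    have : |s| ≤ R := by simpa using hs
    have h2 := sq_abs s
    nlinarith [abs_nonneg s]
  have hne : japWeight q R ≠ 0 := by
    have : 0 < ((1 + R ^ 2) ^ q)⁻¹ := by positivity
    simpa [japWeight] using this
  refine (measure_mono hR).trans_lt ?_
  by_contra htop
  rw [not_lt, top_le_iff] at htop
  rw [htop, ENNReal.mul_top hne] at h1
  exact absurd hq (not_lt.2 h1)

theorem isLocallyFiniteMeasure (h : HasPolyGrowth ν) : IsLocallyFiniteMeasure ν :=
  ⟨fun x => ⟨Metric.ball x 1, Metric.ball_mem_nhds x one_pos, h.measure_lt_top Metric.isBounded_ball⟩⟩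

theorem sigmaFinite (h : HasPolyGrowth ν) : SigmaFinite ν := by
  have := h.isLocallyFiniteMeasure
  infer_instance

theorem integrable {E : Type*} [NormedAddCommGroup E] (h : HasPolyGrowth ν) {g : ℝ → E}
    (hg : AEStronglyMeasurable g ν)
    (hdecay : ∀ q : ℕ, ∃ C : ℝ, ∀ s, (1 + s ^ 2) ^ q * ‖g s‖ ≤ C) : Integrable g ν := by
  obtain ⟨q, hq⟩ := h
  obtain ⟨C, hC⟩ := hdecay q
  have hi : Integrable (fun s : ℝ => ((1 + s ^ 2) ^ q)⁻¹) ν := by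
    refine ⟨Measurable.aestronglyMeasurable (by fun_prop), ?_⟩
    rw [hasFiniteIntegral_iff_ofReal (Eventually.of_forall fun s => by positivity)]
    exact hq
  refine (hi.const_mul C).mono' hg (Eventually.of_forall fun s => ?_)
  rw [← div_eq_mul_inv, le_div_iff₀ (by positivity), mul_comm]
  exact hC s

theorem integrable_ft (h : HasPolyGrowth ν) (θ : TestFn) : Integrable θ.ft ν :=
  h.integrable θ.continuous_ft.aestronglyMeasurable fun q =>
    let ⟨C, _, hC⟩ := θ.exists_ft_decay q; ⟨C, hC⟩

theorem integrable_norm_ft_sq (h : HasPolyGrowth ν) (θ : TestFn) :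
    Integrable (fun s => ‖θ.ft s‖ ^ 2) ν := by
  refine h.integrable (θ.continuous_ft.norm.pow 2).aestronglyMeasurable fun q => ?_
  obtain ⟨C, hC0, hC⟩ := θ.exists_ft_decay q
  refine ⟨C * C, fun s => ?_⟩
  rw [norm_pow, norm_norm]
  have h1 := hC s
  have h2 : ‖θ.ft s‖ ≤ C := le_trans (le_mul_of_one_le_left (norm_nonneg _)
    (one_le_pow₀ (by nlinarith [sq_nonneg s]))) h1
  calc (1 + s ^ 2) ^ q * ‖θ.ft s‖ ^ 2 = ((1 + s ^ 2) ^ q * ‖θ.ft s‖) * ‖θ.ft s‖ := by ring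
    _ ≤ C * C := mul_le_mul h1 h2 (norm_nonneg _) hC0.le

theorem memLp_hat (h : HasPolyGrowth ν) (θ : TestFn) : MemLp θ.hat 2 ν := by
  rw [memLp_two_iff_integrable_sq_norm θ.continuous_hat.aestronglyMeasurable]
  simp_rw [TestFn.norm_hat_sq]
  exact (h.integrable_norm_ft_sq θ).const_mul _

end HasPolyGrowth

/-! ### Separation and density by Fourier transforms -/

section Uniqueness

variable {ν : Measure ℝ}

/-- The positive and negative parts of `F dν` are finite measures with the same characteristic
function, hence equal. -/
theorem ae_eq_zero_of_integral_exp_mul_ofReal {F : ℝ → ℝ} (hF : Integrable F ν)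
    (h : ∀ a : ℝ, ∫ s : ℝ, Complex.exp (Complex.I * a * s) * (F s : ℂ) ∂ν = 0) : F =ᵐ[ν] 0 := by
  have key (G : ℝ → ℝ) (hG : Integrable G ν) :
      IsFiniteMeasure (ν.withDensity fun s => ENNReal.ofReal (G s)) ∧ ∀ a : ℝ,
        charFun (ν.withDensity fun s => ENNReal.ofReal (G s)) a =
          ∫ s : ℝ, Complex.exp (Complex.I * a * s) * ((max (G s) 0 : ℝ) : ℂ) ∂ν := by
    refine ⟨isFiniteMeasure_withDensity_ofReal hG.2, fun a => ?_⟩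
    rw [charFun_apply_real, integral_withDensity_eq_integral_toReal_smul₀
      hG.1.aemeasurable.ennreal_ofReal (Eventually.of_forall fun s => ENNReal.ofReal_lt_top)]
    refine integral_congr_ae (Eventually.of_forall fun s => ?_)
    dsimp only
    rw [ENNReal.toReal_ofReal', Complex.real_smul, mul_comm]
    congr 2
    ring
  obtain ⟨hfin1, h1⟩ := key F hF
  obtain ⟨hfin2, h2⟩ := key (fun s => -F s) hF.neg
  have hint (G : ℝ → ℝ) (hG : Integrable G ν) (a : ℝ) :
      Integrable (fun s : ℝ => Complex.exp (Complex.I * a * s) * ((G s : ℝ) : ℂ)) ν := by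
    refine hG.ofReal.bdd_mul (c := 1) (Continuous.aestronglyMeasurable (by fun_prop))
      (Eventually.of_forall fun s => ?_)
    rw [Complex.norm_exp]
    simp
  have heq : (ν.withDensity fun s => ENNReal.ofReal (F s)) =
      ν.withDensity fun s => ENNReal.ofReal (-F s) := by
    refine Measure.ext_of_charFun (funext fun a => ?_)
    rw [h1, h2, ← sub_eq_zero, ← integral_sub (hint _ hF.pos_part a) (hint _ hF.neg_part a),
      ← h a]
    refine integral_congr_ae (Eventually.of_forall fun s => ?_)
    dsimp only
    rw [← mul_sub, ← Complex.ofReal_sub]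
    congr 2
    rcases le_total (F s) 0 with hs | hs
    · rw [max_eq_right hs, max_eq_left (by linarith)]; ring
    · rw [max_eq_left hs, max_eq_right (by linarith)]; ring
  refine hF.ae_eq_zero_of_forall_setIntegral_eq_zero fun S hS _ => ?_
  rw [integral_eq_lintegral_pos_part_sub_lintegral_neg_part hF.restrict,
    ← withDensity_apply _ hS, ← withDensity_apply _ hS, heq, sub_self]

/-- Conjugating the hypothesis at `-a` gives it for `conj F`, hence for the real and imaginary
parts. -/
theorem ae_eq_zero_of_integral_exp_mul {F : ℝ → ℂ} (hF : Integrable F ν)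
    (h : ∀ a : ℝ, ∫ s : ℝ, Complex.exp (Complex.I * a * s) * F s ∂ν = 0) : F =ᵐ[ν] 0 := by
  have hint (G : ℝ → ℂ) (hG : Integrable G ν) (a : ℝ) :
      Integrable (fun s : ℝ => Complex.exp (Complex.I * a * s) * G s) ν := by
    refine hG.bdd_mul (c := 1) (Continuous.aestronglyMeasurable (by fun_prop))
      (Eventually.of_forall fun s => ?_)
    rw [Complex.norm_exp]
    simp
  have hFc : Integrable (fun s => conj (F s)) ν :=
    hF.mono (Complex.continuous_conj.comp_aestronglyMeasurable hF.1)
      (Eventually.of_forall fun s => by simp)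
  have h' (a : ℝ) : ∫ s : ℝ, Complex.exp (Complex.I * a * s) * conj (F s) ∂ν = 0 := by
    have h1 := congrArg conj (h (-a))
    rw [← integral_conj, map_zero] at h1
    rw [← h1]
    refine integral_congr_ae (Eventually.of_forall fun s => ?_)
    simp [← Complex.exp_conj]
  have hre := ae_eq_zero_of_integral_exp_mul_ofReal (F := fun s => (F s).re) hF.re fun a => by
    have e (s : ℝ) : Complex.exp (Complex.I * a * s) * (((F s).re : ℝ) : ℂ) =
        (Complex.exp (Complex.I * a * s) * F s + Complex.exp (Complex.I * a * s) * conj (F s)) *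
          (1 / 2) := by
      rw [Complex.re_eq_add_conj]; ring
    simp_rw [e]
    rw [integral_mul_const, integral_add (hint _ hF a) (hint _ hFc a), h, h', add_zero, zero_mul]
  have him := ae_eq_zero_of_integral_exp_mul_ofReal (F := fun s => (F s).im) hF.im fun a => by
    have e (s : ℝ) : Complex.exp (Complex.I * a * s) * (((F s).im : ℝ) : ℂ) =
        (Complex.exp (Complex.I * a * s) * F s - Complex.exp (Complex.I * a * s) * conj (F s)) *
          (1 / (2 * Complex.I)) := by
      rw [Complex.im_eq_sub_conj]; ring
    simp_rw [e]
    rw [integral_mul_const, integral_sub (hint _ hF a) (hint _ hFc a), h, h', sub_zero, zero_mul]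
  filter_upwards [hre, him] with s h1 h2
  exact Complex.ext h1 h2

/-- The Fourier transforms of the test functions separate densities. -/
theorem ae_eq_zero_of_integral_ft_mul {G : ℝ → ℂ}
    (hint : ∀ θ : TestFn, Integrable (fun s => θ.ft s * G s) ν)
    (h : ∀ θ : TestFn, ∫ s, θ.ft s * G s ∂ν = 0) : G =ᵐ[ν] 0 := by
  let b := TestFn.bump
  let θ := b.corr b.conjugate
  have hcont : Continuous fun s => ‖b.ft s‖ ^ 2 := b.continuous_ft.norm.pow 2
  have hpos : 0 < ‖b.ft 0‖ ^ 2 := by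
    have := norm_pos_iff.2 TestFn.ft_bump_zero
    positivity
  obtain ⟨ε, hε, hεa⟩ := Metric.eventually_nhds_iff.1
    (hcont.continuousAt.eventually_const_lt (hpos : (0 : ℝ) < _))
  -- Translating a test function multiplies its transform by a character, so every character is
  -- available. Rational `t` keep the exceptional sets countable in number.
  have hzero (t : ℚ) : (fun s => (θ.modulate t).ft s * G s) =ᵐ[ν] 0 := by
    refine ae_eq_zero_of_integral_exp_mul (hint _) fun a => ?_
    rw [← h ((θ.modulate t).translate a)]
    refine integral_congr_ae (Eventually.of_forall fun s => ?_)
    dsimp only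
    rw [TestFn.ft_translate]
    ring
  filter_upwards [ae_all_iff.2 hzero] with s hs
  obtain ⟨t, ht1, ht2⟩ := exists_rat_btwn (show s - ε < s by linarith)
  have h1 := hs t
  have h2 : ‖b.ft (s - t)‖ ^ 2 ≠ 0 := by
    refine (hεa (y := s - t) ?_).ne'
    rw [Real.dist_eq, sub_zero, abs_of_pos (by linarith)]
    linarith
  simp only [Pi.zero_apply, TestFn.ft_modulate, θ, TestFn.ft_corr, mul_eq_zero,
    Complex.ofReal_eq_zero] at h1
  exact h1.resolve_left h2

/-- Separation applied to the difference of the densities with respect to `σ + σ'`; no difference of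
infinite measures is formed. -/
theorem HasPolyGrowth.eq_of_integral_ft_eq {σ σ' : Measure ℝ} (hσ : HasPolyGrowth σ)
    (hσ' : HasPolyGrowth σ') (h : ∀ θ : TestFn, ∫ s, θ.ft s ∂σ = ∫ s, θ.ft s ∂σ') : σ = σ' := by
  have i1 := hσ.sigmaFinite
  have i2 := hσ'.sigmaFinite
  have ac1 : σ ≪ σ + σ' := Measure.absolutelyContinuous_of_le (Measure.le_add_right le_rfl)
  have ac2 : σ' ≪ σ + σ' := Measure.absolutelyContinuous_of_le (Measure.le_add_left le_rfl)
  obtain ⟨f, hf⟩ : ∃ f, f = σ.rnDeriv (σ + σ') := ⟨_, rfl⟩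
  obtain ⟨f', hf'⟩ : ∃ f', f' = σ'.rnDeriv (σ + σ') := ⟨_, rfl⟩
  have hi1 (θ : TestFn) : Integrable (fun s => (f s).toReal • θ.ft s) (σ + σ') := by
    rw [hf]; exact (integrable_rnDeriv_smul_iff ac1).2 (hσ.integrable_ft θ)
  have hi2 (θ : TestFn) : Integrable (fun s => (f' s).toReal • θ.ft s) (σ + σ') := by
    rw [hf']; exact (integrable_rnDeriv_smul_iff ac2).2 (hσ'.integrable_ft θ)
  have he1 (θ : TestFn) : ∫ s, (f s).toReal • θ.ft s ∂(σ + σ') = ∫ s, θ.ft s ∂σ := by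
    rw [hf]; exact integral_rnDeriv_smul ac1
  have he2 (θ : TestFn) : ∫ s, (f' s).toReal • θ.ft s ∂(σ + σ') = ∫ s, θ.ft s ∂σ' := by
    rw [hf']; exact integral_rnDeriv_smul ac2
  have e (θ : TestFn) (s : ℝ) : θ.ft s * (((f s).toReal : ℂ) - (f' s).toReal) =
      (f s).toReal • θ.ft s - (f' s).toReal • θ.ft s := by
    rw [Complex.real_smul, Complex.real_smul]; ring
  have hz := ae_eq_zero_of_integral_ft_mul (ν := σ + σ')
    (G := fun s => ((f s).toReal : ℂ) - (f' s).toReal)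
    (fun θ => by simp_rw [e]; exact (hi1 θ).sub (hi2 θ))
    (fun θ => by
      simp_rw [e]
      rw [integral_sub (hi1 θ) (hi2 θ), he1, he2, h, sub_self])
  have hd1 := Measure.withDensity_rnDeriv_eq σ (σ + σ') ac1
  have hd2 := Measure.withDensity_rnDeriv_eq σ' (σ + σ') ac2
  rw [← hf] at hd1
  rw [← hf'] at hd2
  have hlt1 : ∀ᵐ s ∂(σ + σ'), f s < ∞ := by rw [hf]; exact σ.rnDeriv_lt_top _
  have hlt2 : ∀ᵐ s ∂(σ + σ'), f' s < ∞ := by rw [hf']; exact σ'.rnDeriv_lt_top _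
  refine hd1.symm.trans (Eq.trans (withDensity_congr_ae ?_) hd2)
  filter_upwards [hz, hlt1, hlt2] with s hs h1 h2
  rw [Pi.zero_apply, sub_eq_zero, Complex.ofReal_inj] at hs
  exact (ENNReal.toReal_eq_toReal_iff' h1.ne h2.ne).1 hs

/-- The Fourier transforms of the test functions are dense in `L²` of a measure of polynomial
growth. -/
theorem HasPolyGrowth.exists_hat_near (hν : HasPolyGrowth ν) {g : ℝ → ℂ} (hg : MemLp g 2 ν)
    {ε : ℝ≥0∞} (hε : ε ≠ 0) : ∃ θ : TestFn, eLpNorm (fun s => θ.hat s - g s) 2 ν < ε := by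
  let L : TestFn →ₗ[ℂ] Lp ℂ 2 ν :=
    { toFun := fun θ => (hν.memLp_hat θ).toLp _
      map_add' := fun f g => by
        rw [← MemLp.toLp_add]
        refine MemLp.toLp_congr _ _ (Eventually.of_forall fun s => ?_)
        simp [TestFn.hat, TestFn.ft_add, mul_add]
      map_smul' := fun c f => by
        rw [RingHom.id_apply, ← MemLp.toLp_const_smul]
        refine MemLp.toLp_congr _ _ (Eventually.of_forall fun s => ?_)
        simp [TestFn.hat, TestFn.ft_smul]
        ring }
  -- An element orthogonal to all transforms vanishes by the separation property.
  have hdense : (LinearMap.range L).topologicalClosure = ⊤ := by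
    rw [Submodule.topologicalClosure_eq_top_iff, Submodule.eq_bot_iff]
    intro F hF
    have hF' (θ : TestFn) : ∫ s, conj (F s) * θ.hat s ∂ν = 0 := by
      have h1 := (Submodule.mem_orthogonal' _ _).1 hF (L θ) (LinearMap.mem_range_self L θ)
      rw [L2.inner_def] at h1
      rw [← h1]
      refine integral_congr_ae ?_
      filter_upwards [(hν.memLp_hat θ).coeFn_toLp] with s hs
      rw [RCLike.inner_apply, mul_comm]
      change _ = (hν.memLp_hat θ).toLp _ s * _
      rw [hs]
    have hint (θ : TestFn) : Integrable (fun s => conj (F s) * θ.hat s) ν := by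
      have hc : MemLp (fun s => conj (F s)) 2 ν := by
        refine (Lp.memLp F).of_le (Complex.continuous_conj.comp_aestronglyMeasurable
          (Lp.aestronglyMeasurable F)) (Eventually.of_forall fun s => by simp)
      exact hc.integrable_mul (hν.memLp_hat θ)
    obtain ⟨c, hc⟩ : ∃ c : ℂ, c = ((Real.sqrt (2 * Real.pi) : ℝ) : ℂ) := ⟨_, rfl⟩
    have hc0 : c ≠ 0 := by
      rw [hc]
      exact Complex.ofReal_ne_zero.2 (Real.sqrt_pos.2 Real.two_pi_pos).ne'
    have e (θ : TestFn) (s : ℝ) : θ.ft s * conj (F s) = c * (conj (F s) * θ.hat s) := by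
      rw [TestFn.hat, ← hc]; field_simp
    have hz := ae_eq_zero_of_integral_ft_mul (ν := ν) (G := fun s => conj (F s))
      (fun θ => by simp_rw [e]; exact (hint θ).const_mul _)
      (fun θ => by simp_rw [e]; rw [integral_const_mul, hF', mul_zero])
    refine Lp.ext ?_
    filter_upwards [hz, Lp.coeFn_zero ℂ 2 ν] with s h1 h2
    rw [h2]
    simpa using h1
  have hmem : hg.toLp g ∈ closure (LinearMap.range L : Set (Lp ℂ 2 ν)) := by
    rw [← Submodule.topologicalClosure_coe, hdense]
    trivial
  obtain ⟨_, ⟨θ, rfl⟩, hθ⟩ := EMetric.mem_closure_iff.1 hmem ε (pos_iff_ne_zero.2 hε)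
  refine ⟨θ, ?_⟩
  rw [edist_comm] at hθ
  change edist ((hν.memLp_hat θ).toLp _) (hg.toLp g) < ε at hθ
  rwa [Lp.edist_toLp_toLp] at hθ

end Uniqueness

/-! ### Jordan decomposition of infinite measures -/

section Jordan

variable {α : Type*} [MeasurableSpace α]

/-- The Jordan decomposition of the difference of two `σ`-finite measures. -/
theorem MeasureTheory.Measure.exists_mutuallySingular_add_eq (a b : Measure α) [SigmaFinite a]
    [SigmaFinite b] : ∃ p n : Measure α, p ⟂ₘ n ∧ p + b = a + n ∧ p ≤ a ∧ n ≤ b := by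
  obtain ⟨f, hf, hfa⟩ : ∃ f : α → ℝ≥0∞, Measurable f ∧ (a + b).withDensity f = a :=
    ⟨a.rnDeriv (a + b), Measure.measurable_rnDeriv _ _, Measure.withDensity_rnDeriv_eq _ _
      (Measure.absolutelyContinuous_of_le (Measure.le_add_right le_rfl))⟩
  obtain ⟨h, hh, hhb⟩ : ∃ h : α → ℝ≥0∞, Measurable h ∧ (a + b).withDensity h = b :=
    ⟨b.rnDeriv (a + b), Measure.measurable_rnDeriv _ _, Measure.withDensity_rnDeriv_eq _ _
      (Measure.absolutelyContinuous_of_le (Measure.le_add_left le_rfl))⟩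
  have hset : MeasurableSet {x | f x ≤ h x} := measurableSet_le hf hh
  -- Subtraction is truncated, so these are the positive parts of `f - h` and `h - f`; they are
  -- supported on complementary sets.
  refine ⟨(a + b).withDensity fun x => f x - h x, (a + b).withDensity fun x => h x - f x,
    ⟨{x | f x ≤ h x}, hset, ?_, ?_⟩, ?_, ?_, ?_⟩
  · rw [withDensity_apply _ hset, setLIntegral_congr_fun (g := fun _ => 0) hset
      (fun x (hx : f x ≤ h x) => tsub_eq_zero_of_le hx), lintegral_zero]
  · rw [withDensity_apply _ hset.compl, setLIntegral_congr_fun (g := fun _ => 0) hset.compl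
      (fun x (hx : ¬ f x ≤ h x) => tsub_eq_zero_of_le (le_of_not_ge hx)), lintegral_zero]
  · have e : ((fun x => f x - h x) + h) = f + fun x => h x - f x := by
      ext x
      simp only [Pi.add_apply]
      rw [tsub_add_eq_max, add_comm, tsub_add_eq_max, max_comm]
    have h1 := withDensity_add_right (μ := a + b) (fun x => f x - h x) hh
    have h2 := withDensity_add_left (μ := a + b) hf (fun x => h x - f x)
    rw [e, h2, hfa, hhb] at h1
    exact h1.symm
  · exact (withDensity_mono (Eventually.of_forall fun x => tsub_le_self)).trans_eq hfa
  · exact (withDensity_mono (Eventually.of_forall fun x => tsub_le_self)).trans_eq hhb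

/-- Minimality of the Jordan decomposition: `n` vanishes on a set carrying `p`, where the identity
gives `p ≤ p'`. The additive form avoids subtracting infinite values. -/
theorem MeasureTheory.Measure.MutuallySingular.le_of_add_eq {p n p' n' : Measure α}
    (h : p ⟂ₘ n) (he : p + n' = p' + n) : p ≤ p' := by
  obtain ⟨S, hS, hp, hn⟩ := h
  refine Measure.le_iff.2 fun B hB => ?_
  have h1 : p B = p (B ∩ Sᶜ) := by
    rw [← measure_inter_add_sdiff B hS, measure_mono_null inter_subset_right hp, zero_add]
    rfl
  have h2 := congrArg (fun μ : Measure α => μ (B ∩ Sᶜ)) he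
  simp only [Measure.add_apply] at h2
  rw [measure_mono_null (μ := n) (s := B ∩ Sᶜ) inter_subset_right hn, add_zero] at h2
  calc p B = p (B ∩ Sᶜ) := h1
    _ ≤ p (B ∩ Sᶜ) + n' (B ∩ Sᶜ) := le_self_add
    _ = p' (B ∩ Sᶜ) := h2
    _ ≤ p' B := measure_mono inter_subset_left

end Jordan

/-! ### The representing measure -/

namespace PolyMeasure

theorem exists_growth_iff (μ : Measure ℝ) :
    (∃ p : ℝ, ∫⁻ s, ENNReal.ofReal ((1 + s ^ 2) ^ (-p)) ∂μ < ∞) ↔ HasPolyGrowth μ := by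
  constructor
  · rintro ⟨p, hp⟩
    refine ⟨⌈p⌉₊, (lintegral_mono fun s => ENNReal.ofReal_le_ofReal ?_).trans_lt hp⟩
    rw [← Real.rpow_natCast, ← Real.rpow_neg (by positivity)]
    exact Real.rpow_le_rpow_of_exponent_le (by nlinarith [sq_nonneg s])
      (neg_le_neg (Nat.le_ceil p))
  · rintro ⟨q, hq⟩
    refine ⟨q, lt_of_eq_of_lt (lintegral_congr fun s => ?_) hq⟩
    rw [japWeight, Real.rpow_neg (by positivity), Real.rpow_natCast]

theorem hasPolyGrowth (M : PolyMeasure) : HasPolyGrowth (M.pos + M.neg) :=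
  (exists_growth_iff _).1 M.growth

theorem hasPolyGrowth_pos (M : PolyMeasure) : HasPolyGrowth M.pos :=
  M.hasPolyGrowth.mono (Measure.le_add_right le_rfl)

theorem hasPolyGrowth_neg (M : PolyMeasure) : HasPolyGrowth M.neg :=
  M.hasPolyGrowth.mono (Measure.le_add_left le_rfl)

theorem represents_iff (M : PolyMeasure) (w : AntiDistribution) : M.Represents w ↔
    ∀ θ : TestFn, w θ = (2 * Real.pi : ℂ)⁻¹ * M.integral fun s => conj (θ.ft s) := by
  simp only [Represents, TestFn.conj_ft]

/-- Adding the negative parts crosswise gives an identity between positive measures, settled by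
their transforms; minimality, used in both directions, then identifies the Jordan parts. -/
theorem Represents.unique {M M' : PolyMeasure} {w : AntiDistribution} (h : M.Represents w)
    (h' : M'.Represents w) : M' = M := by
  rw [represents_iff] at h h'
  have hpi : (2 * Real.pi : ℂ)⁻¹ ≠ 0 := by
    have : (Real.pi : ℂ) ≠ 0 := by exact_mod_cast Real.pi_ne_zero
    simp [this]
  have key : M'.pos + M.neg = M.pos + M'.neg := by
    refine (M'.hasPolyGrowth_pos.add M.hasPolyGrowth_neg).eq_of_integral_ft_eq
      (M.hasPolyGrowth_pos.add M'.hasPolyGrowth_neg) fun θ => ?_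
    rw [integral_add_measure (M'.hasPolyGrowth_pos.integrable_ft θ)
      (M.hasPolyGrowth_neg.integrable_ft θ),
      integral_add_measure (M.hasPolyGrowth_pos.integrable_ft θ)
      (M'.hasPolyGrowth_neg.integrable_ft θ)]
    have h1 := mul_left_cancel₀ hpi ((h θ).symm.trans (h' θ))
    simp only [integral, integral_conj, ← map_sub] at h1
    have h2 := RingHom.injective (starRingEnd ℂ) h1
    linear_combination -h2
  have key2 : M'.neg + M.pos = M.neg + M'.pos := by
    rw [add_comm, ← key, add_comm]
  refine PolyMeasure.ext ?_ ?_
  · exact le_antisymm (M'.mutuallySingular.le_of_add_eq key)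
      (M.mutuallySingular.le_of_add_eq key.symm)
  · exact le_antisymm (M'.mutuallySingular.symm.le_of_add_eq key2)
      (M.mutuallySingular.symm.le_of_add_eq key2.symm)

/-- The real measure `ν + γ dx`. -/
theorem exists_eq_add_smul_volume {ν : Measure ℝ} (hν : HasPolyGrowth ν) (γ : ℝ) :
    ∃ M : PolyMeasure, M.pos + ENNReal.ofReal (-γ) • volume =
      ν + ENNReal.ofReal γ • volume + M.neg ∧ M.neg ≤ ENNReal.ofReal (-γ) • volume := by
  have hα := hν.add (HasPolyGrowth.volume.smul (c := ENNReal.ofReal γ) ENNReal.ofReal_ne_top)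
  have hβ := HasPolyGrowth.volume.smul (c := ENNReal.ofReal (-γ)) ENNReal.ofReal_ne_top
  have := hα.sigmaFinite
  have := hβ.sigmaFinite
  -- Only the negative part of `γ` is subtracted, so the negative part of `M` is dominated by a
  -- multiple of Lebesgue measure.
  obtain ⟨p, n, hpn, he, hp, hn⟩ := Measure.exists_mutuallySingular_add_eq
    (ν + ENNReal.ofReal γ • volume) (ENNReal.ofReal (-γ) • (volume : Measure ℝ))
  exact ⟨⟨p, n, hpn, (exists_growth_iff _).2 ((hα.mono hp).add (hβ.mono hn))⟩, he, hn⟩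

theorem integral_eq_add {ν : Measure ℝ} {γ : ℝ} {M : PolyMeasure}
    (h : M.pos + ENNReal.ofReal (-γ) • volume = ν + ENNReal.ofReal γ • volume + M.neg)
    {g : ℝ → ℂ} (h1 : Integrable g M.pos) (h2 : Integrable g M.neg) (h3 : Integrable g ν)
    (h4 : Integrable g volume) : M.integral g = ∫ s, g s ∂ν + γ * ∫ s, g s := by
  have h5 (c : ℝ) : Integrable g (ENNReal.ofReal c • volume) :=
    h4.smul_measure ENNReal.ofReal_ne_top
  have h6 := congrArg (fun μ : Measure ℝ => ∫ s, g s ∂μ) h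
  rw [integral_add_measure h1 (h5 _), integral_add_measure (h3.add_measure (h5 _)) h2,
    integral_add_measure h3 (h5 _), integral_smul_measure, integral_smul_measure,
    ENNReal.toReal_ofReal', ENNReal.toReal_ofReal', Complex.real_smul, Complex.real_smul] at h6
  have h7 : (γ : ℂ) = ((max γ 0 : ℝ) : ℂ) - ((max (-γ) 0 : ℝ) : ℂ) := by
    rw [← Complex.ofReal_sub]
    congr 1
    rcases le_total γ 0 with hs | hs
    · rw [max_eq_right hs, max_eq_left (by linarith)]; ring
    · rw [max_eq_left hs, max_eq_right (by linarith)]; ring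
  rw [integral, h7]
  linear_combination h6

theorem le_val {ν : Measure ℝ} (hν : HasPolyGrowth ν) {γ : ℝ} {M : PolyMeasure}
    (h : M.pos + ENNReal.ofReal (-γ) • volume = ν + ENNReal.ofReal γ • volume + M.neg)
    {X : Set ℝ} (hX : Bornology.IsBounded X) : γ * volume.real X ≤ M.val X := by
  have f1 := (M.hasPolyGrowth_pos.measure_lt_top hX).ne
  have f2 := (M.hasPolyGrowth_neg.measure_lt_top hX).ne
  have f3 := (hν.measure_lt_top hX).ne
  have f4 (c : ℝ) : (ENNReal.ofReal c • (volume : Measure ℝ)) X ≠ ∞ :=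
    ((HasPolyGrowth.volume.smul ENNReal.ofReal_ne_top).measure_lt_top hX).ne
  have h6 := congrArg (fun μ : Measure ℝ => μ.real X) h
  rw [measureReal_add_apply f1 (f4 _), measureReal_add_apply (by
    rw [Measure.add_apply]; exact ENNReal.add_ne_top.2 ⟨f3, f4 _⟩) f2,
    measureReal_add_apply f3 (f4 _), measureReal_ennreal_smul_apply,
    measureReal_ennreal_smul_apply, ENNReal.toReal_ofReal', ENNReal.toReal_ofReal'] at h6
  have h7 : γ = max γ 0 - max (-γ) 0 := by
    rcases le_total γ 0 with hs | hs
    · rw [max_eq_right hs, max_eq_left (by linarith)]; ring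
    · rw [max_eq_left hs, max_eq_right (by linarith)]; ring
  have h8 : γ * volume.real X = max γ 0 * volume.real X - max (-γ) 0 * volume.real X := by
    rw [← sub_mul, ← h7]
  have h9 : 0 ≤ ν.real X := measureReal_nonneg
  rw [val]
  linarith

end PolyMeasure

/-- The representing measure of a convolution form bounded from below. -/
theorem AntiDistribution.exists_represents {w : AntiDistribution} (hw : w.IsHermitian) {γ : ℝ}
    (hγ : ∀ f : TestFn, γ * ‖f.toL2‖ ^ 2 ≤ w.form f) :
    ∃ M : PolyMeasure, M.Represents w ∧
      (∀ X : Set ℝ, Bornology.IsBounded X → γ * volume.real X ≤ M.val X) ∧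
      M.neg ≤ ENNReal.ofReal (-γ) • volume := by
  obtain ⟨ν, q, hq, hν⟩ := AntiDistribution.exists_measure_of_form_ge hw hγ
  have hg : HasPolyGrowth ν := ⟨q, hq⟩
  obtain ⟨M, hM, hneg⟩ := PolyMeasure.exists_eq_add_smul_volume hg γ
  refine ⟨M, ?_, fun X hX => PolyMeasure.le_val hg hM hX, hneg⟩
  rw [PolyMeasure.represents_iff]
  intro θ
  have hi {μ : Measure ℝ} (h : HasPolyGrowth μ) : Integrable (fun s => conj (θ.ft s)) μ := by
    refine (h.integrable_ft θ).mono
      (Complex.continuous_conj.comp θ.continuous_ft).aestronglyMeasurable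
      (Eventually.of_forall fun s => by simp)
  rw [hν, PolyMeasure.integral_eq_add hM (hi M.hasPolyGrowth_pos) (hi M.hasPolyGrowth_neg) (hi hg)
    (hi HasPolyGrowth.volume)]

/-! ### The form in `L²(|M| + dx)` and closability -/

theorem eLpNorm_two_pow_two {α E : Type*} [MeasurableSpace α] [NormedAddCommGroup E]
    (f : α → E) (μ : Measure α) : eLpNorm f 2 μ ^ 2 = ∫⁻ x, ‖f x‖ₑ ^ 2 ∂μ := by
  have h := eLpNorm_nnreal_pow_eq_lintegral (f := f) (μ := μ) (p := 2) two_ne_zero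
  simpa [ENNReal.rpow_ofNat] using h

theorem eLpNorm_hatL2 (f : Lp ℂ 2 (volume : Measure ℝ)) : eLpNorm (hatL2 f) 2 volume = ‖f‖ₑ := by
  have h := (eLpNorm_two_pow_two (hatL2 f) volume).trans (lintegral_hatL2 f)
  exact (ENNReal.pow_right_strictMono two_ne_zero).injective h

/-- Continuity of the `L²` norm with respect to a smaller measure. -/
theorem tendsto_integral_norm_sq_of_le {α : Type*} [MeasurableSpace α] {μ ν : Measure α}
    (hle : μ ≤ ν) {u : ℕ → α → ℂ} {g : α → ℂ} (hu : ∀ n, MemLp (u n) 2 ν) (hg : MemLp g 2 ν)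
    (h : Tendsto (fun n => eLpNorm (u n - g) 2 ν) atTop (𝓝 0)) :
    Tendsto (fun n => ∫ x, ‖u n x‖ ^ 2 ∂μ) atTop (𝓝 (∫ x, ‖g x‖ ^ 2 ∂μ)) := by
  have hu' (n : ℕ) := (hu n).mono_measure hle
  have hg' := hg.mono_measure hle
  have hlim : Tendsto (fun n => (hu' n).toLp (u n)) atTop (𝓝 (hg'.toLp g)) := by
    rw [Lp.tendsto_Lp_iff_tendsto_eLpNorm'']
    exact tendsto_of_tendsto_of_tendsto_of_le_of_le tendsto_const_nhds h (fun _ => zero_le)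
      fun n => eLpNorm_mono_measure _ hle
  have h2 := hlim.norm.pow 2
  rw [norm_toLp_two_sq] at h2
  simpa only [norm_toLp_two_sq] using h2

namespace PolyMeasure

/-- The measure `|M| + dx`. -/
def addVolume (M : PolyMeasure) : Measure ℝ := M.pos + M.neg + volume

variable (M : PolyMeasure)

theorem hasPolyGrowth_addVolume : HasPolyGrowth M.addVolume :=
  M.hasPolyGrowth.add HasPolyGrowth.volume

theorem pos_le_addVolume : M.pos ≤ M.addVolume :=
  (Measure.le_add_right le_rfl).trans (Measure.le_add_right le_rfl)

theorem neg_le_addVolume : M.neg ≤ M.addVolume :=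
  (Measure.le_add_left le_rfl).trans (Measure.le_add_right le_rfl)

theorem volume_le_addVolume : volume ≤ M.addVolume := Measure.le_add_left le_rfl

/-- The image of a test function in `L²(|M| + dx)`. -/
def hatLp (f : TestFn) : Lp ℂ 2 M.addVolume := (M.hasPolyGrowth_addVolume.memLp_hat f).toLp _

theorem coeFn_hatLp (f : TestFn) : M.hatLp f =ᵐ[M.addVolume] f.hat :=
  (M.hasPolyGrowth_addVolume.memLp_hat f).coeFn_toLp

theorem hatLp_sub (f g : TestFn) : M.hatLp (f - g) = M.hatLp f - M.hatLp g := by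
  rw [hatLp, hatLp, hatLp, ← MemLp.toLp_sub]
  exact MemLp.toLp_congr _ _ (Eventually.of_forall fun s => TestFn.hat_sub f g s)

theorem integral_norm_hat_sq_volume (f : TestFn) : ∫ s, ‖f.hat s‖ ^ 2 = ‖f.toL2‖ ^ 2 := by
  have h1 := eLpNorm_hatL2 f.toL2
  rw [eLpNorm_congr_ae f.hatL2_toL2] at h1
  rw [← norm_toLp_two_sq (HasPolyGrowth.volume.memLp_hat f), Lp.norm_toLp, h1, toReal_enorm]

theorem norm_hatLp_sq (f : TestFn) : ‖M.hatLp f‖ ^ 2 =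
    (∫ s, ‖f.hat s‖ ^ 2 ∂M.pos) + (∫ s, ‖f.hat s‖ ^ 2 ∂M.neg) + ‖f.toL2‖ ^ 2 := by
  have hi {μ : Measure ℝ} (h : HasPolyGrowth μ) : Integrable (fun s => ‖f.hat s‖ ^ 2) μ :=
    (h.memLp_hat f).integrable_norm_pow two_ne_zero
  rw [hatLp, norm_toLp_two_sq, addVolume, integral_add_measure (hi M.hasPolyGrowth)
    (hi HasPolyGrowth.volume), integral_add_measure (hi M.hasPolyGrowth_pos)
    (hi M.hasPolyGrowth_neg), integral_norm_hat_sq_volume]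

variable {M} {w : AntiDistribution}

theorem Represents.form_eq (h : M.Represents w) (f : TestFn) :
    w.form f = (∫ s, ‖f.hat s‖ ^ 2 ∂M.pos) - ∫ s, ‖f.hat s‖ ^ 2 ∂M.neg := by
  rw [represents_iff] at h
  have e (s : ℝ) : conj ((f.corr f.conjugate).ft s) = ((‖f.ft s‖ ^ 2 : ℝ) : ℂ) := by
    rw [TestFn.ft_corr, Complex.conj_ofReal]
  rw [AntiDistribution.form, h]
  simp_rw [TestFn.norm_hat_sq, e]
  rw [PolyMeasure.integral, integral_complex_ofReal, integral_complex_ofReal, integral_const_mul,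
    integral_const_mul, ← mul_sub, ← Complex.ofReal_sub]
  have : (2 * Real.pi : ℂ)⁻¹ = (((2 * Real.pi)⁻¹ : ℝ) : ℂ) := by push_cast; rfl
  rw [this, ← Complex.ofReal_mul, Complex.ofReal_re]

/-- The form is a difference of two squared `L²` norms, each continuous in the norm of `L²(|M| +
dx)`. -/
theorem Represents.tendsto_form (h : M.Represents w) {u : ℕ → TestFn} {g : ℝ → ℂ}
    (hg : MemLp g 2 M.addVolume)
    (hu : Tendsto (fun n => eLpNorm ((u n).hat - g) 2 M.addVolume) atTop (𝓝 0)) :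
    Tendsto (fun n => w.form (u n)) atTop (𝓝 (M.integral fun s => ‖g s‖ ^ 2)) := by
  simp_rw [h.form_eq]
  exact (tendsto_integral_norm_sq_of_le M.pos_le_addVolume
    (fun n => M.hasPolyGrowth_addVolume.memLp_hat (u n)) hg hu).sub
    (tendsto_integral_norm_sq_of_le M.neg_le_addVolume
    (fun n => M.hasPolyGrowth_addVolume.memLp_hat (u n)) hg hu)

theorem Represents.abs_form_le (h : M.Represents w) (f : TestFn) :
    |w.form f| ≤ ‖M.hatLp f‖ ^ 2 := by
  have h1 : 0 ≤ ∫ s, ‖f.hat s‖ ^ 2 ∂M.pos := integral_nonneg fun s => by positivity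
  have h2 : 0 ≤ ∫ s, ‖f.hat s‖ ^ 2 ∂M.neg := integral_nonneg fun s => by positivity
  rw [h.form_eq, norm_hatLp_sq, abs_le]
  constructor <;> nlinarith [sq_nonneg ‖f.toL2‖]

/-- Replacing `M` by `|M|` adds twice the negative part, at most `2c‖f‖²`, and `dx` adds `‖f‖²`.
With `abs_form_le` this makes the form norm equivalent to that of `L²(|M| + dx)`. -/
theorem Represents.norm_hatLp_sq_le (h : M.Represents w) {c : ℝ} (hc : 0 ≤ c)
    (hneg : M.neg ≤ ENNReal.ofReal c • volume) (f : TestFn) :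
    ‖M.hatLp f‖ ^ 2 ≤ w.form f + (2 * c + 1) * ‖f.toL2‖ ^ 2 := by
  have h1 : ∫ s, ‖f.hat s‖ ^ 2 ∂M.neg ≤ c * ‖f.toL2‖ ^ 2 := by
    have h2 := integral_mono_measure hneg (f := fun s => ‖f.hat s‖ ^ 2)
      (Eventually.of_forall fun s => by positivity)
      (((HasPolyGrowth.volume.smul ENNReal.ofReal_ne_top).memLp_hat f).integrable_norm_pow
        two_ne_zero)
    rwa [integral_smul_measure, ENNReal.toReal_ofReal hc, integral_norm_hat_sq_volume,
      smul_eq_mul] at h2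
  rw [norm_hatLp_sq, h.form_eq]
  linarith

/-- A form-Cauchy sequence converges in `L²(|M| + dx)`. -/
theorem Represents.exists_tendsto_of_approximates (h : M.Represents w) {c : ℝ} (hc : 0 ≤ c)
    (hneg : M.neg ≤ ENNReal.ofReal c • volume) {u : ℕ → TestFn} {f : Lp ℂ 2 (volume : Measure ℝ)}
    (hu : QuadForm.Approximates TestFn.toL2 w.form u f) :
    ∃ g : ℝ → ℂ, MemLp g 2 M.addVolume ∧ hatL2 f =ᵐ[volume] g ∧
      Tendsto (fun n => eLpNorm ((u n).hat - g) 2 M.addVolume) atTop (𝓝 0) := by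
  obtain ⟨hu1, hu2⟩ := hu
  have hdist : Tendsto (fun p : ℕ × ℕ => ‖(u p.1 - u p.2).toL2‖) atTop (𝓝 0) := by
    have := cauchySeq_iff_tendsto_dist_atTop_0.1 hu1.cauchySeq
    simpa only [dist_eq_norm, TestFn.toL2_sub] using this
  have hcauchy : CauchySeq fun n => M.hatLp (u n) := by
    rw [cauchySeq_iff_tendsto_dist_atTop_0]
    have h1 : Tendsto (fun p : ℕ × ℕ => w.form (u p.1 - u p.2) +
        (2 * c + 1) * ‖(u p.1 - u p.2).toL2‖ ^ 2) atTop (𝓝 0) := by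
      simpa using hu2.add ((hdist.pow 2).const_mul (2 * c + 1))
    have h2 : Tendsto (fun p : ℕ × ℕ => ‖M.hatLp (u p.1 - u p.2)‖ ^ 2) atTop (𝓝 0) :=
      squeeze_zero (fun p => by positivity) (fun p => h.norm_hatLp_sq_le hc hneg _) h1
    have h3 := (Real.continuous_sqrt.tendsto 0).comp h2
    simpa [Function.comp_def, Real.sqrt_sq, dist_eq_norm, hatLp_sub] using h3
  obtain ⟨G, hG⟩ := cauchySeq_tendsto_of_complete hcauchy
  have hlim : Tendsto (fun n => eLpNorm ((u n).hat - ⇑G) 2 M.addVolume) atTop (𝓝 0) := by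
    have h1 := (Lp.tendsto_Lp_iff_tendsto_eLpNorm' _ _).1 hG
    refine h1.congr fun n => eLpNorm_congr_ae ?_
    filter_upwards [M.coeFn_hatLp (u n)] with s hs
    simp [hs]
  refine ⟨⇑G, Lp.memLp G, ?_, hlim⟩
  have hmeas : AEStronglyMeasurable (⇑G) volume :=
    (Lp.aestronglyMeasurable G).mono_measure M.volume_le_addVolume
  -- The transforms of `u n` converge in `L²(dx)` both to `G` and to the transform of `f`. Agreement
  -- holds only up to Lebesgue-null sets, which `M` may charge.
  have h1 (n : ℕ) : eLpNorm (hatL2 f - ⇑G) 2 volume ≤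
      ‖(u n).toL2 - f‖ₑ + eLpNorm ((u n).hat - ⇑G) 2 M.addVolume := by
    have e1 : eLpNorm (hatL2 f - (u n).hat) 2 volume = ‖(u n).toL2 - f‖ₑ := by
      rw [← eLpNorm_hatL2, ← eLpNorm_neg]
      refine eLpNorm_congr_ae ?_
      filter_upwards [hatL2_sub (u n).toL2 f, (u n).hatL2_toL2] with s h1 h2
      rw [h1, h2]
      simp
    calc eLpNorm (hatL2 f - ⇑G) 2 volume
        = eLpNorm ((hatL2 f - (u n).hat) + ((u n).hat - ⇑G)) 2 volume := by
          congr 1; ring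
      _ ≤ eLpNorm (hatL2 f - (u n).hat) 2 volume + eLpNorm ((u n).hat - ⇑G) 2 volume :=
          eLpNorm_add_le ((aestronglyMeasurable_hatL2 f).sub
            (u n).continuous_hat.aestronglyMeasurable)
            ((u n).continuous_hat.aestronglyMeasurable.sub hmeas) (by norm_num)
      _ ≤ _ := by
          rw [e1]
          gcongr
          exact M.volume_le_addVolume
  have h2 : Tendsto (fun n => ‖(u n).toL2 - f‖ₑ + eLpNorm ((u n).hat - ⇑G) 2 M.addVolume) atTop
      (𝓝 0) := by
    have h3 : Tendsto (fun n => ‖(u n).toL2 - f‖ₑ) atTop (𝓝 0) := by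
      have := (hu1.sub_const f).enorm
      simpa using this
    simpa using h3.add hlim
  have h4 : eLpNorm (hatL2 f - ⇑G) 2 volume = 0 :=
    le_antisymm (ge_of_tendsto' h2 h1) zero_le
  rw [eLpNorm_eq_zero_iff ((aestronglyMeasurable_hatL2 f).sub hmeas) two_ne_zero] at h4
  filter_upwards [h4] with s hs
  exact sub_eq_zero.1 hs

/-- Density of transforms in `L²(|M| + dx)`. The values of `g` on a Lebesgue-null set are not tied
to `f`; this freedom is what breaks closability when `M` has a singular part. -/
theorem Represents.exists_approximates (h : M.Represents w) {f : Lp ℂ 2 (volume : Measure ℝ)}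
    {g : ℝ → ℂ} (hg : MemLp g 2 M.addVolume) (hfg : hatL2 f =ᵐ[volume] g) :
    ∃ u : ℕ → TestFn, QuadForm.Approximates TestFn.toL2 w.form u f ∧
      Tendsto (fun n => eLpNorm ((u n).hat - g) 2 M.addVolume) atTop (𝓝 0) := by
  choose u hu using fun n : ℕ => M.hasPolyGrowth_addVolume.exists_hat_near hg
    (ε := ((n : ℝ≥0∞) + 1)⁻¹) (by simp)
  have hlim : Tendsto (fun n => eLpNorm ((u n).hat - g) 2 M.addVolume) atTop (𝓝 0) := by
    refine tendsto_of_tendsto_of_tendsto_of_le_of_le tendsto_const_nhds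
      (h := fun n : ℕ => ((n : ℝ≥0∞) + 1)⁻¹) ?_ (fun _ => zero_le) fun n => (hu n).le
    have := (tendsto_add_atTop_iff_nat 1).2 ENNReal.tendsto_inv_nat_nhds_zero
    simpa using this
  refine ⟨u, ⟨?_, ?_⟩, hlim⟩
  · rw [tendsto_iff_edist_tendsto_0]
    refine tendsto_of_tendsto_of_tendsto_of_le_of_le tendsto_const_nhds hlim
      (fun _ => zero_le) fun n => ?_
    rw [edist_eq_enorm_sub, ← eLpNorm_hatL2]
    refine le_trans (le_of_eq (eLpNorm_congr_ae ?_)) (eLpNorm_mono_measure _ M.volume_le_addVolume)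
    filter_upwards [hatL2_sub (u n).toL2 f, (u n).hatL2_toL2, hfg] with s h1 h2 h3
    rw [h1, h2, h3, Pi.sub_apply]
  · have h1 : Tendsto (fun n => M.hatLp (u n)) atTop (𝓝 (hg.toLp g)) :=
      (Lp.tendsto_Lp_iff_tendsto_eLpNorm'' _ _ _ _).2 hlim
    have h2 := (cauchySeq_iff_tendsto_dist_atTop_0.1 h1.cauchySeq).pow 2
    refine squeeze_zero_norm (a := fun p : ℕ × ℕ => dist (M.hatLp (u p.1)) (M.hatLp (u p.2)) ^ 2)
      (fun p => ?_) (by simpa using h2)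
    rw [dist_eq_norm, ← hatLp_sub]
    exact h.abs_form_le _

theorem IsAbsolutelyContinuous.addVolume (hac : M.IsAbsolutelyContinuous) :
    M.addVolume ≪ volume := by
  intro s hs
  have h1 : M.variation s = 0 := hac hs
  rw [PolyMeasure.addVolume, Measure.add_apply, hs, add_zero]
  exact h1

theorem integral_congr_of_absolutelyContinuous (hac : M.IsAbsolutelyContinuous)
    {g g' : ℝ → ℝ} (h : g =ᵐ[volume] g') : M.integral g = M.integral g' := by
  have h1 := hac.addVolume.ae_eq h
  rw [PolyMeasure.integral, PolyMeasure.integral,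
    integral_congr_ae (ae_mono M.pos_le_addVolume h1),
    integral_congr_ae (ae_mono M.neg_le_addVolume h1)]

theorem Represents.tendsto_of_approximates (h : M.Represents w) {c : ℝ} (hc : 0 ≤ c)
    (hneg : M.neg ≤ ENNReal.ofReal c • volume) (hac : M.IsAbsolutelyContinuous) {u : ℕ → TestFn}
    {f : Lp ℂ 2 (volume : Measure ℝ)} (hu : QuadForm.Approximates TestFn.toL2 w.form u f) :
    Tendsto (fun n => w.form (u n)) atTop (𝓝 (M.integral fun s => ‖hatL2 f s‖ ^ 2)) := by
  obtain ⟨g, hg, hfg, hlim⟩ := h.exists_tendsto_of_approximates hc hneg hu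
  rw [integral_congr_of_absolutelyContinuous hac (g' := fun s => ‖g s‖ ^ 2)
    (hfg.mono fun s hs => by simp only [hs])]
  exact h.tendsto_form hg hlim

theorem Represents.closable (h : M.Represents w) {c : ℝ} (hc : 0 ≤ c)
    (hneg : M.neg ≤ ENNReal.ofReal c • volume) (hac : M.IsAbsolutelyContinuous) :
    QuadForm.Closable TestFn.toL2 w.form := by
  intro u hu
  have h1 := h.tendsto_of_approximates hc hneg hac hu
  rwa [integral_congr_of_absolutelyContinuous hac (g' := fun _ => 0)
    (hatL2_zero.mono fun s hs => by simp [hs]),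
    show M.integral (fun _ => (0 : ℝ)) = 0 by simp [PolyMeasure.integral]] at h1

/-- The indicator of a bounded Lebesgue-null set is approximated by transforms of functions tending
to zero in `L²(ℝ)`, so closability forces its `M`-measure to vanish. The negative part is absolutely
continuous anyway. -/
theorem Represents.isAbsolutelyContinuous (h : M.Represents w) {c : ℝ}
    (hneg : M.neg ≤ ENNReal.ofReal c • volume)
    (hcl : QuadForm.Closable TestFn.toL2 w.form) : M.IsAbsolutelyContinuous := by
  have hnegac : M.neg ≪ volume :=
    (Measure.absolutelyContinuous_of_le hneg).trans Measure.smul_absolutelyContinuous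
  have key (S : Set ℝ) (hS : MeasurableSet S) (hSb : Bornology.IsBounded S)
      (hS0 : volume S = 0) : M.pos S = 0 := by
    have hfin := M.hasPolyGrowth_addVolume.measure_lt_top hSb
    have hg : MemLp (S.indicator fun _ => (1 : ℂ)) 2 M.addVolume :=
      memLp_indicator_const 2 hS 1 (Or.inr hfin.ne)
    have hzero : hatL2 0 =ᵐ[volume] S.indicator fun _ => (1 : ℂ) := by
      have h1 : ∀ᵐ s : ℝ, s ∉ S := measure_eq_zero_iff_ae_notMem.1 hS0
      filter_upwards [hatL2_zero, h1] with s h2 h3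
      rw [h2, indicator_of_notMem h3]
    obtain ⟨u, hu, hlim⟩ := h.exists_approximates hg hzero
    have h1 := tendsto_nhds_unique (h.tendsto_form hg hlim) (hcl u hu)
    have e (μ : Measure ℝ) : ∫ s, ‖S.indicator (fun _ => (1 : ℂ)) s‖ ^ 2 ∂μ = μ.real S := by
      rw [← integral_indicator_one hS]
      refine integral_congr_ae (Eventually.of_forall fun s => ?_)
      by_cases hs : s ∈ S <;> simp [hs]
    rw [PolyMeasure.integral, e, e, measureReal_def M.neg, hnegac hS0, ENNReal.toReal_zero,
      sub_zero] at h1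
    exact (measureReal_eq_zero_iff (M.hasPolyGrowth_pos.measure_lt_top hSb).ne).1 h1
  refine Measure.AbsolutelyContinuous.mk fun S hS hS0 => ?_
  rw [variation, Measure.add_apply, hnegac hS0, add_zero]
  have hun : S = ⋃ n : ℕ, S ∩ Metric.closedBall 0 n := by
    rw [← inter_iUnion, Metric.iUnion_closedBall_nat, inter_univ]
  rw [hun, measure_iUnion_null_iff]
  exact fun n => key _ (hS.inter Metric.isClosed_closedBall.measurableSet)
    (Metric.isBounded_closedBall.subset inter_subset_right)
    (measure_mono_null inter_subset_left hS0)

theorem Represents.closedOn (h : M.Represents w) {c : ℝ} (hc : 0 ≤ c)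
    (hneg : M.neg ≤ ENNReal.ofReal c • volume) (hac : M.IsAbsolutelyContinuous) :
    QuadForm.ClosedOn TestFn.toL2 w.form (energySpace M)
      (fun f => M.integral fun s => ‖hatL2 f s‖ ^ 2) where
  closable := h.closable hc hneg hac
  domain_eq := by
    refine Set.ext fun f => ⟨?_, fun hf => ?_⟩
    · rintro ⟨u, hu⟩
      obtain ⟨g, hg, hfg, -⟩ := h.exists_tendsto_of_approximates hc hneg hu
      have h1 : hatL2 f =ᵐ[M.variation] g := hac.ae_eq hfg
      have h2 : eLpNorm g 2 M.variation < ∞ :=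
        (hg.mono_measure (Measure.le_add_right le_rfl)).2
      change ∫⁻ s, ‖hatL2 f s‖ₑ ^ 2 ∂M.variation < ∞
      rw [← eLpNorm_two_pow_two, eLpNorm_congr_ae h1]
      exact ENNReal.pow_lt_top h2
    -- Finite energy and Plancherel give the norm; absolute continuity gives measurability with
    -- respect to `|M|`.
    · have h1 : MemLp (hatL2 f) 2 M.addVolume := by
        refine ⟨(aestronglyMeasurable_hatL2 f).mono_ac hac.addVolume, ?_⟩
        have h2 : eLpNorm (hatL2 f) 2 M.addVolume ^ 2 < ∞ := by
          rw [eLpNorm_two_pow_two, PolyMeasure.addVolume, lintegral_add_measure, lintegral_hatL2]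
          exact ENNReal.add_lt_top.2 ⟨hf, ENNReal.pow_lt_top enorm_lt_top⟩
        by_contra htop
        rw [not_lt, top_le_iff] at htop
        rw [htop] at h2
        simp at h2
      obtain ⟨u, hu, -⟩ := h.exists_approximates h1 (ae_eq_refl _)
      exact ⟨u, hu⟩
  extension := fun _ _ _ hu => h.tendsto_of_approximates hc hneg hac hu

end PolyMeasure

end

theorem theorem3p1 (w : AntiDistribution) (hw : w.IsHermitian) (γ : ℝ)
    (hγ : ∀ f : TestFn, γ * ‖f.toL2‖ ^ 2 ≤ w.form f) :
    ∃ M : PolyMeasure,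
      -- the representing measure: existence, uniqueness, lower bound
      M.Represents w ∧
      (∀ M' : PolyMeasure, M'.Represents w → M' = M) ∧
      (∀ X : Set ℝ, MeasurableSet X → Bornology.IsBounded X → γ * volume.real X ≤ M.val X) ∧
      -- closability
      (QuadForm.Closable TestFn.toL2 w.form ↔ M.IsAbsolutelyContinuous) ∧
      -- the domain on which the form is closed
      (M.IsAbsolutelyContinuous →
        QuadForm.ClosedOn TestFn.toL2 w.form (energySpace M)
          (fun f => M.integral fun s => ‖hatL2 f s‖ ^ 2)) := by
  obtain ⟨M, hM, hval, hneg⟩ := AntiDistribution.exists_represents hw hγ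
  -- The comparison of norms needs a nonnegative constant; `ENNReal.ofReal` does not see the change.
  have hneg' : M.neg ≤ ENNReal.ofReal (max (-γ) 0) • volume := by
    rw [ENNReal.ofReal_max, ENNReal.ofReal_zero, max_eq_left zero_le]
    exact hneg
  exact ⟨M, hM, fun M' hM' => hM.unique hM', fun X _ hX => hval X hX,
    ⟨hM.isAbsolutelyContinuous hneg', hM.closable (le_max_right _ _) hneg'⟩,
    hM.closedOn (le_max_right _ _) hneg'⟩
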